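/- Let $0<\alpha\le 1$, $0<\beta<1$ and $F\subseteq\mathbb R$. For $x\le y$ and $\delta>0$ put $\gamma^\alpha_\delta(F,x,y)=\inf\sum_{i<n}\frac{(t_{i+1}-t_i)^\alpha}{\Gamma(\alpha+1)}\,\Theta(F,[t_i,t_{i+1}])$, the infimum over all subdivisions $x=t_0\le\dots\le t_n=y$ of mesh at most $\delta$, where $\Theta(F,I)=1$ if $F\cap I\ne\emptyset$ and $0$ otherwise; let $\gamma^\alpha(F,x,y)=\lim_{\delta\to0}\gamma^\alpha_\delta(F,x,y)$, and let $S=S_F^\alpha$ be the staircase function, $S(x)=\gamma^\alpha(F,0,x)$ for $x\ge0$ and $S(x)=-\gamma^\alpha(F,x,0)$ for $x<0$. Assume that $F$ is $\alpha$-perfect (that is, $\gamma^\alpha(F,x,y)<\infty$ for all $x\le y$, and $F$ is exactly the set of points around which $S$ is not constant on any open interval) and that $S(t)\to\infty$ as $t\to\infty$. Let $d_F^\alpha t$ denote integration with respect to the Lebesgue–Stieltjes measure of $S$, and let $D_F^\alpha f(x)=\lim_{y\to x,\,y\in F}\frac{f(y)-f(x)}{S(y)-S(x)}$ for $x\in F$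 and $D_F^\alpha f(x)=0$ for $x\notin F$. Put $$\Gamma_F^\alpha(x)=\int_0^\infty e^{-S(t)}S(t)^{x-1}\,d_F^\alpha t,\qquad E_F^\alpha(z)=\sum_{j=0}^\infty\frac{z^j}{\Gamma_F^\alpha(\beta j+1)},$$ $$D^\beta p(t)=\frac1{\Gamma_F^\alpha(1-\beta)}\int_0^t (S(t)-S(\tau))^{-\beta}\,D_F^\alpha p(\tau)\,d_F^\alpha\tau .$$ A price path is a function $p$ that is continuous on $[0,\infty)$, locally constant on $(0,\infty)\setminus F$, and $F^\alpha$-differentiable at every $t\in F$ with $S(t)>0$. A price path $p$ solves an equation in $D^\beta p$ if for every $t$ with $S(t)>0$ the integral in $D^\beta p(t)$ converges absolutely and the equation holds at $t$. Let $d_0,d_1,s_0,s_1\in\mathbb R$ with $d_1+s_1\ne0$. Then the series $E_F^\alpha(z)$ converges absolutely for every $z\in\mathbb R$, and the following hold. 1. For all $\lambda,p_0\in\mathbb R$, the equation $D^\beta p+\lambda(d_1+s_1)p=\lambda(d_0+s_0)$ has exactly one price path with $p(0)=p_0$ as a solution (on $[0,\infty)$), namely $$p(t)=p_0\,E_F^\alpha\big(-\lambda(d_1+s_1)S(t)^\beta\big)+\frac{d_0+s_0}{d_1+s_1}\Big(1-E_F^\alpha\big(-\lambda(d_1+s_1)S(t)^\beta\big)\Big),\qquad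 t\ge0.$$ 2. For all $d_2,s_2\in\mathbb R$ with $d_2+s_2\ne0$ and all $p_0\in\mathbb R$, the equation with expectations $D^\beta p-\frac{d_1+s_1}{d_2+s_2}p=-\frac{d_0+s_0}{d_2+s_2}$ has exactly one price path with $p(0)=p_0$ as a solution (on $[0,\infty)$), namely $$p(t)=p_0\,E_F^\alpha\Big(\frac{d_1+s_1}{d_2+s_2}S(t)^\beta\Big)+\frac{d_0+s_0}{d_1+s_1}\Big(1-E_F^\alpha\Big(\frac{d_1+s_1}{d_2+s_2}S(t)^\beta\Big)\Big),\qquad t\ge0.$$ -/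

import Mathlib

open MeasureTheory Filter Topology Set
open scoped ENNReal

noncomputable section

namespace FractalCalculus

open Classical in
/-- The flag function `Θ(F, [x, y])`. -/
def flag (F : Set ℝ) (x y : ℝ) : ℝ≥0∞ := if (F ∩ Icc x y).Nonempty then 1 else 0

/-- `t 0, …, t n` is a subdivision of `[x, y]` of mesh at most `δ`
(the values of `t` beyond `n` are irrelevant). -/
structure IsSubdivision (x y δ : ℝ) (n : ℕ) (t : ℕ → ℝ) : Prop where
  mono : Monotone t
  left : t 0 = x
  right : t n = y
  mesh : ∀ i < n, t (i + 1) - t i ≤ δ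

/-- The sum `σ^α[F, P] = ∑ (t (i+1) - t i)^α / Γ(α + 1) * Θ(F, [t i, t (i+1)])`. -/
def subdivisionSum (F : Set ℝ) (α : ℝ) (n : ℕ) (t : ℕ → ℝ) : ℝ≥0∞ :=
  ∑ i ∈ Finset.range n,
    ENNReal.ofReal ((t (i + 1) - t i) ^ α / Real.Gamma (α + 1)) * flag F (t i) (t (i + 1))

/-- The coarse-grained mass `γ_δ^α(F, x, y)`, for `x ≤ y`. -/
def coarseMass (F : Set ℝ) (α δ x y : ℝ) : ℝ≥0∞ :=
  ⨅ (n : ℕ) (t : ℕ → ℝ) (_ : IsSubdivision x y δ n t), subdivisionSum F α n t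

/-- The mass function `γ^α(F, x, y) = lim_{δ → 0} γ_δ^α(F, x, y)`, for `x ≤ y`. The coarse-grained
mass grows as `δ` decreases, so the limit is a supremum; it may be infinite. -/
def mass (F : Set ℝ) (α x y : ℝ) : ℝ≥0∞ := ⨆ (δ : ℝ) (_ : 0 < δ), coarseMass F α δ x y

/-- The integral staircase function `S_F^α` with base point `0`. -/
def staircase (F : Set ℝ) (α x : ℝ) : ℝ :=
  if 0 ≤ x then (mass F α 0 x).toReal else -(mass F α x 0).toReal

/-- `Sch(f)`: the points of change of `f`, i.e. the points around which `f` is not constant on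
any open interval. -/
def pointsOfChange (f : ℝ → ℝ) : Set ℝ :=
  {x | ∀ c d : ℝ, c < x → x < d → ∃ y ∈ Ioo c d, ∃ z ∈ Ioo c d, f y ≠ f z}

/-- `F` is `α`-perfect: the staircase function is finite everywhere and `F` is exactly its set of
points of change. -/
structure IsAlphaPerfect (F : Set ℝ) (α : ℝ) : Prop where
  mass_ne_top : ∀ x y : ℝ, x ≤ y → mass F α x y ≠ ∞
  pointsOfChange_eq : pointsOfChange (staircase F α) = F

/-- The difference quotient of `f` at `x` with respect to the staircase function. -/
def fractalSlope (F : Set ℝ) (α : ℝ) (f : ℝ → ℝ) (x y : ℝ) : ℝ :=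
  (f y - f x) / (staircase F α y - staircase F α x)

/-- `f` is `F^α`-differentiable at `x ∈ F`: the difference quotient has a limit through the points
of `F`. -/
def FractalDifferentiableAt (F : Set ℝ) (α : ℝ) (f : ℝ → ℝ) (x : ℝ) : Prop :=
  ∃ l : ℝ, Tendsto (fractalSlope F α f x) (𝓝[F \ {x}] x) (𝓝 l)

open Classical in
/-- The `F^α`-derivative `D_F^α f`: the limit of the difference quotients through `F` at the points
of `F`, and `0` off `F`. -/
def fractalDeriv (F : Set ℝ) (α : ℝ) (f : ℝ → ℝ) (x : ℝ) : ℝ :=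
  if x ∈ F then limUnder (𝓝[F \ {x}] x) (fractalSlope F α f x) else 0

open Classical in
/-- The measure `d_F^α t`: the Lebesgue-Stieltjes measure of the staircase function. (If `F` has
finite mass on bounded intervals, then the staircase function is monotone.) -/
def fractalMeasure (F : Set ℝ) (α : ℝ) : Measure ℝ :=
  if h : Monotone (staircase F α) then h.stieltjesFunction.measure else 0

/-- The fractal Gamma function `∫_0^∞ e^{-S(t)} S(t)^{x-1} d_F^α t`, where `S = S_F^α` and the
argument `x` is a value of the staircase coordinate. -/
def fractalGamma (F : Set ℝ) (α x : ℝ) : ℝ :=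
  ∫ t in Ioi (0 : ℝ),
    Real.exp (-staircase F α t) * staircase F α t ^ (x - 1) ∂(fractalMeasure F α)

/-- The general term `z^j / Γ_F^α(ηj + a)` of the fractal Mittag-Leffler series, at the value `z` of
the staircase coordinate. -/
def mittagLefflerTerm (F : Set ℝ) (α η a z : ℝ) (j : ℕ) : ℝ :=
  z ^ j / fractalGamma F α (η * j + a)

/-- The fractal Mittag-Leffler function `∑_j z^j / Γ_F^α(ηj + a)`. -/
def fractalMittagLeffler (F : Set ℝ) (α η a z : ℝ) : ℝ :=
  ∑' j : ℕ, mittagLefflerTerm F α η a z j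

/-- The integrand `(S(x) - S(t))^{-β} D_F^α f(t)` of the Caputo fractal derivative. -/
def caputoIntegrand (F : Set ℝ) (α β : ℝ) (f : ℝ → ℝ) (x t : ℝ) : ℝ :=
  (staircase F α x - staircase F α t) ^ (-β) * fractalDeriv F α f t

/-- The integral that defines the Caputo fractal derivative of `f` at `x` converges. -/
def CaputoExistsAt (F : Set ℝ) (α β : ℝ) (f : ℝ → ℝ) (x : ℝ) : Prop :=
  IntegrableOn (caputoIntegrand F α β f x) (Ioc 0 x) (fractalMeasure F α)

/-- The Caputo fractal derivative of order `β ∈ (0, 1)` with base point `0`: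
`1 / Γ_F^α(1 - β) * ∫_0^x (S(x) - S(t))^{-β} D_F^α f(t) d_F^α t`. -/
def caputoDeriv (F : Set ℝ) (α β : ℝ) (f : ℝ → ℝ) (x : ℝ) : ℝ :=
  1 / fractalGamma F α (1 - β) *
    ∫ t in Ioc 0 x, caputoIntegrand F α β f x t ∂(fractalMeasure F α)

/-- The regularity that a price path has: it is continuous on `[0, ∞)`, it changes only on `F`, and
it is `F^α`-differentiable at the points of `F` after the start. (As in the classical case, the
derivative of a solution of an equation of order `β < 1` is singular at the start.) -/
structure IsPricePath (F : Set ℝ) (α : ℝ) (p : ℝ → ℝ) : Prop where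
  continuousOn : ContinuousOn p (Ici 0)
  locallyConstant : ∀ t : ℝ, 0 < t → t ∉ F → ∀ᶠ u in 𝓝 t, p u = p t
  differentiable : ∀ t ∈ F, 0 < staircase F α t → FractalDifferentiableAt F α p t

/-- `p` is a price path, with initial value `p₀`, that solves `D^β p + a p = c` at all times at
which the staircase function has left `0`. -/
structure SolvesCaputo (F : Set ℝ) (α β a c p₀ : ℝ) (p : ℝ → ℝ) : Prop where
  path : IsPricePath F α p
  initial : p 0 = p₀
  exists_deriv : ∀ t : ℝ, 0 < staircase F α t → CaputoExistsAt F α β p t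
  equation : ∀ t : ℝ, 0 < staircase F α t → caputoDeriv F α β p t + a * p t = c

end FractalCalculus

end

/-
Idea: use `S` as a new time coordinate. Its right inverse on `[0, ∞)`, the last time at which `S`
shows `s`, carries Lebesgue measure to the Stieltjes measure of `S` and takes values in `F`, so that
`Γ_F^α` is the classical Gamma function and, for `h s = p (lastTime S s)`, the derivative `D_F^α p`
becomes the ordinary derivative of `h` outside the countably many jumps of the right inverse. A
price path is constant on the intervals of constancy of `S`, so `h` is continuous and determines
`p`, and the equation becomes a classical Caputo equation for `h`.

The Abel kernels `s^(v - 1) / Γ(v)` form a semigroup under convolution. Convolving them with the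
Mittag-Leffler series term by term shows that it solves the equation. Conversely, a fractional
integral of order `β` turns the equation for `h` into a Volterra equation; the difference of two
solutions, iterated `n` times through it, is `O(|b|^n T^(βn) / Γ(βn + 1))`, the general term of a
convergent Mittag-Leffler series, hence zero.
-/

noncomputable section

namespace FractalCalculus

section Mass

variable {F : Set ℝ} {α x y z δ : ℝ}

/-- The contribution `(y - x)^α / Γ(α + 1) * Θ(F, [x, y])` of one cell `[x, y]` to a
subdivision sum. -/
def cellMass (F : Set ℝ) (α x y : ℝ) : ℝ≥0∞ :=
  ENNReal.ofReal ((y - x) ^ α / Real.Gamma (α + 1)) * flag F x y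

/-- The contribution `δ^α / Γ(α + 1)` of a cell of length `δ` that meets `F`: an upper bound for
the contribution of a cell of a subdivision of mesh at most `δ`. -/
def meshBound (α δ : ℝ) : ℝ≥0∞ := ENNReal.ofReal (δ ^ α / Real.Gamma (α + 1))

theorem subdivisionSum_eq_sum_cellMass (F : Set ℝ) (α : ℝ) (n : ℕ) (t : ℕ → ℝ) :
    subdivisionSum F α n t = ∑ i ∈ Finset.range n, cellMass F α (t i) (t (i + 1)) := rfl

theorem flag_le_one (F : Set ℝ) (x y : ℝ) : flag F x y ≤ 1 := by
  unfold flag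
  split_ifs <;> simp

theorem cellMass_self (hα : 0 < α) (F : Set ℝ) (x : ℝ) : cellMass F α x x = 0 := by
  simp [cellMass, Real.zero_rpow hα.ne']

theorem cellMass_le_meshBound (hα : 0 ≤ α) (hxy : x ≤ y) (hδ : y - x ≤ δ) :
    cellMass F α x y ≤ meshBound α δ := by
  have : 0 < Real.Gamma (α + 1) := Real.Gamma_pos_of_pos (by linarith)
  have hpow : (y - x) ^ α ≤ δ ^ α := Real.rpow_le_rpow (sub_nonneg.2 hxy) hδ hα
  calc cellMass F α x y
      ≤ ENNReal.ofReal ((y - x) ^ α / Real.Gamma (α + 1)) :=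
        mul_le_of_le_one_right' (flag_le_one F x y)
    _ ≤ meshBound α δ := ENNReal.ofReal_le_ofReal (by gcongr)

theorem tendsto_meshBound (hα : 0 < α) : Tendsto (meshBound α) (𝓝[>] 0) (𝓝 0) := by
  have h : Continuous (meshBound α) :=
    ENNReal.continuous_ofReal.comp ((Real.continuous_rpow_const hα.le).div_const _)
  simpa [meshBound, Real.zero_rpow hα.ne'] using (h.tendsto 0).mono_left nhdsWithin_le_nhds

theorem coarseMass_le_subdivisionSum {n : ℕ} {t : ℕ → ℝ} (ht : IsSubdivision x y δ n t) :
    coarseMass F α δ x y ≤ subdivisionSum F α n t :=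
  iInf_le_of_le n <| iInf_le_of_le t <| iInf_le_of_le ht le_rfl

theorem antitone_coarseMass (F : Set ℝ) (α x y : ℝ) :
    Antitone fun δ => coarseMass F α δ x y := fun _ _ h =>
  le_iInf fun _ => le_iInf fun _ => le_iInf fun ht =>
    coarseMass_le_subdivisionSum
      ⟨ht.mono, ht.left, ht.right, fun i hi => (ht.mesh i hi).trans h⟩

theorem tendsto_coarseMass (F : Set ℝ) (α x y : ℝ) :
    Tendsto (fun δ => coarseMass F α δ x y) (𝓝[>] 0) (𝓝 (mass F α x y)) := by
  have h := (antitone_coarseMass F α x y).tendsto_nhdsGT 0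
  rwa [sSup_image] at h

theorem coarseMass_le_mass (hδ : 0 < δ) (F : Set ℝ) (α x y : ℝ) :
    coarseMass F α δ x y ≤ mass F α x y :=
  le_iSup₂_of_le δ hδ le_rfl

theorem coarseMass_le_meshBound (hα : 0 ≤ α) (hxy : x ≤ y) (hδ : y - x ≤ δ) :
    coarseMass F α δ x y ≤ meshBound α δ := by
  let t : ℕ → ℝ := fun i => if i = 0 then x else y
  have ht : IsSubdivision x y δ 1 t := by
    refine ⟨monotone_nat_of_le_succ fun n => ?_, by simp [t], by simp [t], fun i hi => ?_⟩
    · rcases n with _ | n <;> simp [t, hxy]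
    · obtain rfl : i = 0 := by omega
      simpa [t] using hδ
  calc coarseMass F α δ x y
      ≤ subdivisionSum F α 1 t := coarseMass_le_subdivisionSum ht
    _ = cellMass F α x y := by simp [subdivisionSum_eq_sum_cellMass, t]
    _ ≤ meshBound α δ := cellMass_le_meshBound hα hxy hδ

theorem IsSubdivision.exists_concat {n m : ℕ} {t u : ℕ → ℝ} (ht : IsSubdivision x y δ n t)
    (hu : IsSubdivision y z δ m u) (F : Set ℝ) (α : ℝ) :
    ∃ v, IsSubdivision x z δ (n + m) v ∧
      subdivisionSum F α (n + m) v = subdivisionSum F α n t + subdivisionSum F α m u := by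
  let v : ℕ → ℝ := fun i => if i ≤ n then t i else u (i - n)
  have hvt : ∀ i ≤ n, v i = t i := fun i hi => by simp [v, hi]
  have hvu : ∀ i, v (n + i) = u i := fun i => by
    rcases i with _ | i
    · simp [v, ht.right, hu.left]
    · simp [v]
  have hvu' : ∀ i, v (n + i + 1) = u (i + 1) := fun i => hvu (i + 1)
  refine ⟨v, ⟨monotone_nat_of_le_succ fun i => ?_, by rw [hvt 0 n.zero_le, ht.left],
    by rw [hvu, hu.right], fun i hi => ?_⟩, ?_⟩
  · rcases lt_or_ge i n with h | h
    · rw [hvt i h.le, hvt (i + 1) h]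
      exact ht.mono i.le_succ
    · obtain ⟨j, rfl⟩ := Nat.exists_eq_add_of_le h
      rw [hvu, hvu']
      exact hu.mono j.le_succ
  · rcases lt_or_ge i n with h | h
    · rw [hvt i h.le, hvt (i + 1) h]
      exact ht.mesh i h
    · obtain ⟨j, rfl⟩ := Nat.exists_eq_add_of_le h
      rw [hvu, hvu']
      exact hu.mesh j (by omega)
  · simp only [subdivisionSum_eq_sum_cellMass, Finset.sum_range_add, hvu, hvu']
    congr 1
    refine Finset.sum_congr rfl fun i hi => ?_
    have hi : i < n := Finset.mem_range.1 hi
    rw [hvt i hi.le, hvt (i + 1) hi]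

theorem coarseMass_le_add (F : Set ℝ) (α δ x y z : ℝ) :
    coarseMass F α δ x z ≤ coarseMass F α δ x y + coarseMass F α δ y z := by
  conv_rhs => unfold coarseMass
  simp only [ENNReal.iInf_add, ENNReal.add_iInf]
  refine le_iInf fun m => le_iInf fun u => le_iInf fun hu => le_iInf fun n => le_iInf fun t =>
    le_iInf fun ht => ?_
  obtain ⟨v, hv, hsum⟩ := ht.exists_concat hu F α
  exact hsum ▸ coarseMass_le_subdivisionSum hv

theorem IsSubdivision.min_right {n : ℕ} {t : ℕ → ℝ} (ht : IsSubdivision x z δ n t) (hxy : x ≤ y)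
    (hyz : y ≤ z) : IsSubdivision x y δ n fun i => min (t i) y where
  mono _ _ h := min_le_min_right _ (ht.mono h)
  left := by simp [ht.left, hxy]
  right := by simp [ht.right, hyz]
  mesh i hi := by
    have := ht.mesh i hi
    have := ht.mono i.le_succ
    grind

theorem IsSubdivision.max_left {n : ℕ} {t : ℕ → ℝ} (ht : IsSubdivision x z δ n t) (hxy : x ≤ y)
    (hyz : y ≤ z) : IsSubdivision y z δ n fun i => max (t i) y where
  mono _ _ h := max_le_max_right _ (ht.mono h)
  left := by simp [ht.left, hxy]
  right := by simp [ht.right, hyz]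
  mesh i hi := by
    have := ht.mesh i hi
    have := ht.mono i.le_succ
    grind

theorem cellMass_min_add_cellMass_max (hα : 0 < α) (hxz : x ≤ z) (hy : ¬(x < y ∧ y < z)) :
    cellMass F α (min x y) (min z y) + cellMass F α (max x y) (max z y) = cellMass F α x z := by
  rcases le_or_gt y x with h | h
  · simp [h, h.trans hxz, cellMass_self hα]
  · have hzy : z ≤ y := not_lt.1 fun h' => hy ⟨h, h'⟩
    simp [h.le, hzy, cellMass_self hα]

theorem card_crossing_le_one {t : ℕ → ℝ} (ht : Monotone t) (y : ℝ) (n : ℕ) :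
    {i ∈ Finset.range n | t i < y ∧ y < t (i + 1)}.card ≤ 1 := by
  refine Finset.card_le_one.2 fun i hi j hj => ?_
  simp only [Finset.mem_filter] at hi hj
  by_contra hne
  rcases lt_or_gt_of_ne hne with h | h
  · exact (hi.2.2.trans_le (ht h)).not_gt hj.2.1
  · exact (hj.2.2.trans_le (ht h)).not_gt hi.2.1

theorem coarseMass_add_le (hα : 0 < α) (hxy : x ≤ y) (hyz : y ≤ z) :
    coarseMass F α δ x y + coarseMass F α δ y z ≤ coarseMass F α δ x z + 2 * meshBound α δ := by
  conv_rhs => unfold coarseMass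
  simp only [ENNReal.iInf_add]
  refine le_iInf fun n => le_iInf fun t => le_iInf fun ht => ?_
  have hu := ht.min_right hxy hyz
  have hv := ht.max_left hxy hyz
  refine (add_le_add (coarseMass_le_subdivisionSum hu) (coarseMass_le_subdivisionSum hv)).trans ?_
  simp only [subdivisionSum_eq_sum_cellMass]
  rw [← Finset.sum_add_distrib]
  have hcell : ∀ i ∈ Finset.range n,
      cellMass F α (min (t i) y) (min (t (i + 1)) y) +
        cellMass F α (max (t i) y) (max (t (i + 1)) y) ≤
      cellMass F α (t i) (t (i + 1)) +
        if t i < y ∧ y < t (i + 1) then 2 * meshBound α δ else 0 := by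
    intro i hi
    have hi := Finset.mem_range.1 hi
    split_ifs with h
    · rw [two_mul]
      exact le_add_left (add_le_add
        (cellMass_le_meshBound hα.le (hu.mono i.le_succ) (hu.mesh i hi))
        (cellMass_le_meshBound hα.le (hv.mono i.le_succ) (hv.mesh i hi)))
    · rw [add_zero, cellMass_min_add_cellMass_max hα (ht.mono i.le_succ) h]
  refine (Finset.sum_le_sum hcell).trans ?_
  rw [Finset.sum_add_distrib, ← Finset.sum_filter, Finset.sum_const]
  gcongr
  simpa using nsmul_le_nsmul_left (zero_le (a := 2 * meshBound α δ))
    (card_crossing_le_one ht.mono y n)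

theorem mass_add (hα : 0 < α) (hxy : x ≤ y) (hyz : y ≤ z) :
    mass F α x y + mass F α y z = mass F α x z := by
  have hsum := (tendsto_coarseMass F α x y).add (tendsto_coarseMass F α y z)
  apply le_antisymm
  · have hbound : Tendsto (fun δ => coarseMass F α δ x z + 2 * meshBound α δ) (𝓝[>] 0)
        (𝓝 (mass F α x z)) := by
      simpa using (tendsto_coarseMass F α x z).add
        (ENNReal.Tendsto.const_mul (tendsto_meshBound hα) (Or.inr ENNReal.ofNat_ne_top))
    exact le_of_tendsto_of_tendsto' hsum hbound fun δ => coarseMass_add_le hα hxy hyz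
  · exact le_of_tendsto_of_tendsto' (tendsto_coarseMass F α x z) hsum fun δ =>
      coarseMass_le_add F α δ x y z

theorem mass_self (F : Set ℝ) (α x : ℝ) : mass F α x x = 0 := by
  refine le_antisymm (iSup₂_le fun δ _ => ?_) zero_le
  have h : IsSubdivision x x δ 0 fun _ => x := ⟨monotone_const, rfl, rfl, fun i hi => by omega⟩
  exact (coarseMass_le_subdivisionSum h).trans (by simp [subdivisionSum])

theorem eventually_mass_le (hα : 0 < α) {a b : ℝ} (hfin : mass F α a b ≠ ∞) {ε : ℝ≥0∞}
    (hε : 0 < ε) :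
    ∀ᶠ δ in 𝓝[>] (0 : ℝ), ∀ x y, a ≤ x → x ≤ y → y ≤ b → y - x ≤ δ → mass F α x y ≤ ε := by
  have hε2 : 0 < ε / 2 := ENNReal.half_pos hε.ne'
  filter_upwards [self_mem_nhdsWithin,
    (ENNReal.tendsto_nhds hfin).1 (tendsto_coarseMass F α a b) (ε / 2) hε2,
    (tendsto_meshBound hα).eventually_lt_const hε2] with δ hδ hcoarse hmesh x y hax hxy hyb hδ'
  have hax' := mass_add (F := F) hα hax hxy
  have hab := mass_add (F := F) hα (hax.trans hxy) hyb
  have hne : mass F α a x + mass F α y b ≠ ∞ :=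
    ne_top_of_le_ne_top hfin (by rw [← hab, ← hax']; gcongr; exact le_self_add)
  refine (ENNReal.add_le_add_iff_left hne).1 ?_
  calc mass F α a x + mass F α y b + mass F α x y
      = mass F α a b := by rw [← hab, ← hax']; ring
    _ ≤ coarseMass F α δ a b + ε / 2 := tsub_le_iff_right.1 hcoarse.1
    _ ≤ coarseMass F α δ a x + coarseMass F α δ x y + coarseMass F α δ y b + ε / 2 := by
      gcongr
      exact (coarseMass_le_add F α δ a y b).trans (by gcongr; exact coarseMass_le_add F α δ a x y)
    _ ≤ mass F α a x + ε / 2 + mass F α y b + ε / 2 := by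
      gcongr
      · exact coarseMass_le_mass hδ F α a x
      · exact (coarseMass_le_meshBound hα.le hxy hδ').trans hmesh.le
      · exact coarseMass_le_mass hδ F α y b
    _ = mass F α a x + mass F α y b + ε := by
      nth_rw 3 [← ENNReal.add_halves ε]
      ring

theorem staircase_zero (F : Set ℝ) (α : ℝ) : staircase F α 0 = 0 := by
  simp [staircase, mass_self]

theorem staircase_sub (hα : 0 < α) (hfin : ∀ x y : ℝ, x ≤ y → mass F α x y ≠ ∞) (hxy : x ≤ y) :
    staircase F α y - staircase F α x = (mass F α x y).toReal := by
  unfold staircase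
  split_ifs with hy hx hx
  · rw [← mass_add hα hx hxy, ENNReal.toReal_add (hfin _ _ hx) (hfin _ _ hxy)]
    ring
  · have hx := (not_le.1 hx).le
    rw [← mass_add hα hx hy, ENNReal.toReal_add (hfin _ _ hx) (hfin _ _ hy)]
    ring
  · exact absurd (hx.trans hxy) hy
  · have hy := (not_le.1 hy).le
    rw [← mass_add hα hxy hy, ENNReal.toReal_add (hfin _ _ hxy) (hfin _ _ hy)]
    ring

theorem staircase_monotone (hα : 0 < α) (hfin : ∀ x y : ℝ, x ≤ y → mass F α x y ≠ ∞) :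
    Monotone (staircase F α) := fun _ _ h =>
  sub_nonneg.1 <| (staircase_sub hα hfin h).symm ▸ ENNReal.toReal_nonneg

theorem staircase_continuous (hα : 0 < α) (hfin : ∀ x y : ℝ, x ≤ y → mass F α x y ≠ ∞) :
    Continuous (staircase F α) := by
  refine continuous_iff_continuousAt.2 fun x => Metric.continuousAt_iff'.2 fun ε hε => ?_
  have hlt : x - 1 ≤ x + 1 := by linarith
  obtain ⟨δ, hδ, hδ0⟩ := ((eventually_mass_le hα (hfin _ _ hlt)
    (ENNReal.ofReal_pos.2 (half_pos hε))).and self_mem_nhdsWithin).exists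
  have hsmall : ∀ u v, x - 1 ≤ u → u ≤ v → v ≤ x + 1 → v - u ≤ δ →
      staircase F α v - staircase F α u ≤ ε / 2 := fun u v hu huv hv huv' => by
    rw [staircase_sub hα hfin huv]
    exact ENNReal.toReal_le_of_le_ofReal (half_pos hε).le (hδ u v hu huv hv huv')
  have hmono := staircase_monotone hα hfin
  filter_upwards [Metric.ball_mem_nhds x (lt_min hδ0 one_pos)] with y hy
  obtain ⟨hyδ, hy1⟩ := lt_min_iff.1 (Metric.mem_ball.1 hy)
  rw [Real.dist_eq, abs_lt] at *
  rcases le_total x y with h | h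
  · have := hsmall x y (by linarith) h (by linarith) (by linarith)
    constructor <;> linarith [hmono h]
  · have := hsmall y x (by linarith) h (by linarith) (by linarith)
    constructor <;> linarith [hmono h]

end Mass

section AbelIntegral

variable {u v s t T : ℝ} {f : ℝ → ℝ}

/-- The kernel `s^(v - 1) / Γ(v)` of the fractional integral of order `v`, extended by `0` to
`s ≤ 0`. These kernels form a semigroup under convolution, see `integral_abelKernel_mul`. -/
def abelKernel (v : ℝ) : ℝ → ℝ := (Ioi 0).indicator fun s => s ^ (v - 1) / Real.Gamma v

/-- The Riemann–Liouville fractional integral of order `u` with base point `0`. As the kernel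
vanishes on `(-∞, 0]`, only the values of `f` on `(0, t)` matter. -/
def abelIntegral (u : ℝ) (f : ℝ → ℝ) (t : ℝ) : ℝ := ∫ s in Ioi 0, abelKernel u (t - s) * f s

theorem abelKernel_of_pos (v : ℝ) (hs : 0 < s) : abelKernel v s = s ^ (v - 1) / Real.Gamma v :=
  indicator_of_mem (mem_Ioi.2 hs) _

theorem abelKernel_of_nonpos (v : ℝ) (hs : s ≤ 0) : abelKernel v s = 0 :=
  indicator_of_notMem (notMem_Ioi.2 hs) _

theorem abelKernel_one (hs : 0 < s) : abelKernel 1 s = 1 := by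
  simp [abelKernel_of_pos 1 hs]

theorem abelKernel_pos (hv : 0 < v) (hs : 0 < s) : 0 < abelKernel v s := by
  rw [abelKernel_of_pos v hs]
  exact div_pos (Real.rpow_pos_of_pos hs _) (Real.Gamma_pos_of_pos hv)

theorem abelKernel_nonneg (hv : 0 < v) (s : ℝ) : 0 ≤ abelKernel v s := by
  rcases le_or_gt s 0 with hs | hs
  · exact (abelKernel_of_nonpos v hs).ge
  · exact (abelKernel_pos hv hs).le

@[fun_prop]
theorem measurable_abelKernel (v : ℝ) : Measurable (abelKernel v) :=
  Measurable.indicator (by fun_prop) measurableSet_Ioi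

theorem abelKernel_mul_eq_zero (h : T ≤ s) (u v t : ℝ) :
    abelKernel u (T - t) * abelKernel v (t - s) = 0 := by
  rcases le_total t s with hts | hts
  · rw [abelKernel_of_nonpos v (sub_nonpos.2 hts), mul_zero]
  · rw [abelKernel_of_nonpos u (sub_nonpos.2 (h.trans hts)), zero_mul]

theorem integral_rpow_mul_sub_rpow (hu : 0 < u) (hv : 0 < v) (hT : 0 < T) :
    ∫ t in 0..T, t ^ (u - 1) * (T - t) ^ (v - 1) =
      T ^ (u + v - 1) * (Real.Gamma u * Real.Gamma v / Real.Gamma (u + v)) := by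
  have hΓ : Real.Gamma (u + v) ≠ 0 := (Real.Gamma_pos_of_pos (add_pos hu hv)).ne'
  have hbeta := Complex.betaIntegral_scaled u v hT
  have hΓΓ := Complex.Gamma_mul_Gamma_eq_betaIntegral (s := u) (t := v) (by simpa) (by simpa)
  have hint : ∫ t in 0..T, (t : ℂ) ^ ((u : ℂ) - 1) * ((T : ℂ) - t) ^ ((v : ℂ) - 1) =
      ((∫ t in 0..T, t ^ (u - 1) * (T - t) ^ (v - 1) : ℝ) : ℂ) := by
    rw [← intervalIntegral.integral_ofReal]
    refine intervalIntegral.integral_congr fun t ht => ?_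
    rw [uIcc_of_le hT.le] at ht
    simp only [Complex.ofReal_mul, Complex.ofReal_cpow ht.1,
      Complex.ofReal_cpow (sub_nonneg.2 ht.2)]
    push_cast
    rfl
  have hpow : ((T : ℂ) ^ ((u : ℂ) + v - 1)) = ((T ^ (u + v - 1) : ℝ) : ℂ) := by
    rw [Complex.ofReal_cpow hT.le]
    push_cast
    rfl
  rw [hint, hpow] at hbeta
  rw [← Complex.ofReal_add, Complex.Gamma_ofReal, Complex.Gamma_ofReal, Complex.Gamma_ofReal] at hΓΓ
  have hne : ((Real.Gamma (u + v) : ℝ) : ℂ) ≠ 0 := Complex.ofReal_ne_zero.2 hΓ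
  apply Complex.ofReal_injective
  rw [hbeta]
  push_cast
  rw [hΓΓ, mul_div_cancel_left₀ _ hne]

theorem integral_abelKernel_mul (hu : 0 < u) (hv : 0 < v) (s T : ℝ) :
    ∫ t, abelKernel u (T - t) * abelKernel v (t - s) = abelKernel (u + v) (T - s) := by
  rcases le_or_gt T s with h | h
  · simp only [abelKernel_mul_eq_zero h, integral_zero, abelKernel_of_nonpos _ (sub_nonpos.2 h)]
  have hTs : 0 < T - s := sub_pos.2 h
  rw [← integral_add_right_eq_self _ s]
  have hsupp : ∀ t, abelKernel u (T - (t + s)) * abelKernel v (t + s - s) =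
      (Ioo 0 (T - s)).indicator
        (fun t => (Real.Gamma v * Real.Gamma u)⁻¹ * (t ^ (v - 1) * (T - s - t) ^ (u - 1))) t := by
    intro t
    rw [add_sub_cancel_right, show T - (t + s) = T - s - t by ring]
    by_cases ht : t ∈ Ioo 0 (T - s)
    · rw [indicator_of_mem ht, abelKernel_of_pos _ ht.1, abelKernel_of_pos _ (sub_pos.2 ht.2)]
      ring
    · rw [indicator_of_notMem ht]
      rcases le_or_gt t 0 with h0 | h0
      · rw [abelKernel_of_nonpos v h0, mul_zero]
      · rw [abelKernel_of_nonpos u (sub_nonpos.2 (not_lt.1 fun h' => ht ⟨h0, h'⟩)), zero_mul]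
  have hΓu := (Real.Gamma_pos_of_pos hu).ne'
  have hΓv := (Real.Gamma_pos_of_pos hv).ne'
  rw [integral_congr_ae (Eventually.of_forall hsupp), integral_indicator measurableSet_Ioo,
    integral_const_mul, ← integral_Ioc_eq_integral_Ioo, ← intervalIntegral.integral_of_le hTs.le,
    integral_rpow_mul_sub_rpow hv hu hTs, abelKernel_of_pos _ hTs, add_comm v u]
  field_simp

theorem integrable_abelKernel_mul (hu : 0 < u) (hv : 0 < v) (s T : ℝ) :
    Integrable fun t => abelKernel u (T - t) * abelKernel v (t - s) := by
  rcases le_or_gt T s with h | h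
  · simp only [abelKernel_mul_eq_zero h]
    exact integrable_zero ℝ ℝ volume
  · refine Integrable.of_integral_ne_zero ?_
    rw [integral_abelKernel_mul hu hv]
    exact (abelKernel_pos (add_pos hu hv) (sub_pos.2 h)).ne'

theorem abelKernel_mul_of_notMem (u : ℝ) (f : ℝ → ℝ) (hs : s ∈ Ioi 0 \ Ioc 0 T) :
    abelKernel u (T - s) * f s = 0 := by
  have hTs : T < s := not_le.1 fun h => hs.2 ⟨hs.1, h⟩
  rw [abelKernel_of_nonpos u (sub_nonpos.2 hTs.le), zero_mul]

theorem integrableOn_abelKernel_mul_iff :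
    IntegrableOn (fun s => abelKernel u (T - s) * f s) (Ioi 0) ↔
      IntegrableOn (fun s => abelKernel u (T - s) * f s) (Ioc 0 T) :=
  ⟨fun h => h.mono_set Ioc_subset_Ioi_self, fun h =>
    h.of_forall_sdiff_eq_zero measurableSet_Ioi fun _ hs => abelKernel_mul_of_notMem u f hs⟩

theorem abelIntegral_eq_setIntegral_Ioc (u : ℝ) (f : ℝ → ℝ) (T : ℝ) :
    abelIntegral u f T = ∫ s in Ioc 0 T, abelKernel u (T - s) * f s :=
  setIntegral_eq_of_subset_of_forall_sdiff_eq_zero measurableSet_Ioi Ioc_subset_Ioi_self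
    fun _ hs => abelKernel_mul_of_notMem u f hs

theorem ae_restrict_Ioc_lt (T : ℝ) : ∀ᵐ s ∂volume.restrict (Ioc 0 T), s < T := by
  rw [← restrict_Ioo_eq_restrict_Ioc]
  filter_upwards [ae_restrict_mem measurableSet_Ioo] with s hs using hs.2

theorem integrableOn_abelKernel_one_mul_iff :
    IntegrableOn (fun s => abelKernel 1 (T - s) * f s) (Ioi 0) ↔ IntegrableOn f (Ioc 0 T) := by
  rw [integrableOn_abelKernel_mul_iff]
  refine integrable_congr ?_
  filter_upwards [ae_restrict_Ioc_lt T] with s hs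
  rw [abelKernel_one (sub_pos.2 hs), one_mul]

theorem abelIntegral_one (hT : 0 ≤ T) (f : ℝ → ℝ) : abelIntegral 1 f T = ∫ s in 0..T, f s := by
  rw [abelIntegral_eq_setIntegral_Ioc, intervalIntegral.integral_of_le hT]
  refine integral_congr_ae ?_
  filter_upwards [ae_restrict_Ioc_lt T] with s hs
  rw [abelKernel_one (sub_pos.2 hs), one_mul]

theorem abelIntegral_congr {g : ℝ → ℝ} (u T : ℝ) (h : ∀ s, 0 < s → f s = g s) :
    abelIntegral u f T = abelIntegral u g T :=
  setIntegral_congr_fun measurableSet_Ioi fun s hs => by simp only [h s hs]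

theorem abelIntegral_const_mul (u c : ℝ) (f : ℝ → ℝ) (T : ℝ) :
    abelIntegral u (fun s => c * f s) T = c * abelIntegral u f T := by
  unfold abelIntegral
  rw [← integral_const_mul]
  simp only [mul_left_comm]

theorem abelIntegral_sub {g : ℝ → ℝ}
    (hf : IntegrableOn (fun s => abelKernel u (T - s) * f s) (Ioi 0))
    (hg : IntegrableOn (fun s => abelKernel u (T - s) * g s) (Ioi 0)) :
    abelIntegral u (fun s => f s - g s) T = abelIntegral u f T - abelIntegral u g T := by
  simp only [abelIntegral, mul_sub]
  exact integral_sub hf hg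

theorem integrableOn_abelKernel_mul_abelKernel_mul (hu : 0 < u) (hv : 0 < v)
    (hf : ContinuousOn f (Icc 0 T)) :
    IntegrableOn (fun s => abelKernel u (T - s) * (abelKernel v s * f s)) (Ioi 0) := by
  rw [integrableOn_abelKernel_mul_iff, ← integrableOn_Icc_iff_integrableOn_Ioc]
  simpa only [sub_zero, mul_assoc] using
    ((integrable_abelKernel_mul hu hv 0 T).integrableOn (s := Icc 0 T)).mul_continuousOn hf
      isCompact_Icc

theorem integrableOn_abelKernel_mul_of_continuousOn (hu : 0 < u) (hf : ContinuousOn f (Icc 0 T)) :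
    IntegrableOn (fun s => abelKernel u (T - s) * f s) (Ioi 0) :=
  (integrableOn_abelKernel_mul_abelKernel_mul hu one_pos hf).congr_fun
    (fun s hs => by simp only [abelKernel_one hs, one_mul]) measurableSet_Ioi

theorem integrableOn_abelKernel_mul_of_le (hu : 0 < u) (huv : u ≤ v)
    (hf : IntegrableOn (fun s => abelKernel u (T - s) * f s) (Ioi 0)) :
    IntegrableOn (fun s => abelKernel v (T - s) * f s) (Ioi 0) := by
  let φ : ℝ → ℝ := fun s => Real.Gamma u / Real.Gamma v * max (T - s) 0 ^ (v - u)
  have hφ : ContinuousOn φ (Icc 0 T) := by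
    have : Continuous φ := continuous_const.mul
      ((Real.continuous_rpow_const (sub_nonneg.2 huv)).comp (by fun_prop))
    exact this.continuousOn
  have hΓ : Real.Gamma u ≠ 0 := (Real.Gamma_pos_of_pos hu).ne'
  have hker : ∀ s, φ s * abelKernel u (T - s) = abelKernel v (T - s) := fun s => by
    rcases le_or_gt (T - s) 0 with hs | hs
    · rw [abelKernel_of_nonpos u hs, abelKernel_of_nonpos v hs, mul_zero]
    · have hpow : (T - s) ^ (v - u) * (T - s) ^ (u - 1) = (T - s) ^ (v - 1) := by
        rw [← Real.rpow_add hs, sub_add_sub_cancel]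
      simp only [φ, max_eq_left hs.le, abelKernel_of_pos _ hs, ← hpow]
      field_simp
  rw [integrableOn_abelKernel_mul_iff, ← integrableOn_Icc_iff_integrableOn_Ioc] at hf ⊢
  simpa only [← mul_assoc, hker] using hf.continuousOn_mul hφ isCompact_Icc

theorem aestronglyMeasurable_semigroup_integrand (hu : 0 < u) (hv : 0 < v)
    (hf : IntegrableOn (fun s => abelKernel (u + v) (T - s) * f s) (Ioi 0)) :
    AEStronglyMeasurable
      (fun x : ℝ × ℝ => abelKernel u (T - x.1) * (abelKernel v (x.1 - x.2) * f x.2))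
      ((volume.restrict (Ioi 0)).prod (volume.restrict (Ioi 0))) := by
  -- `g` agrees with `f` on `(0, T)`, which is where the hypothesis controls `f`.
  let g : ℝ → ℝ := fun s => (abelKernel (u + v) (T - s))⁻¹ * (abelKernel (u + v) (T - s) * f s)
  have hg : AEStronglyMeasurable g (volume.restrict (Ioi 0)) :=
    AEStronglyMeasurable.mul (Measurable.aestronglyMeasurable (by fun_prop)) hf.aestronglyMeasurable
  have hfg : (fun x : ℝ × ℝ => abelKernel u (T - x.1) * (abelKernel v (x.1 - x.2) * f x.2)) =
      fun x => abelKernel u (T - x.1) * abelKernel v (x.1 - x.2) * g x.2 := by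
    ext ⟨t, s⟩
    rw [← mul_assoc]
    rcases le_or_gt T s with h | h
    · simp only [abelKernel_mul_eq_zero h, zero_mul]
    · simp only [g]
      rw [inv_mul_cancel_left₀ (abelKernel_pos (add_pos hu hv) (sub_pos.2 h)).ne']
  rw [hfg]
  exact AEStronglyMeasurable.mul (Measurable.aestronglyMeasurable (by fun_prop)) hg.comp_snd

theorem setIntegral_abelKernel_mul (hu : 0 < u) (hv : 0 < v) (hs : 0 ≤ s) (T : ℝ) :
    ∫ t in Ioi 0, abelKernel u (T - t) * abelKernel v (t - s) = abelKernel (u + v) (T - s) := by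
  rw [setIntegral_eq_integral_of_forall_compl_eq_zero, integral_abelKernel_mul hu hv]
  intro t ht
  rw [abelKernel_of_nonpos v (sub_nonpos.2 ((notMem_Ioi.1 ht).trans hs)), mul_zero]

theorem abelIntegral_abelIntegral (hu : 0 < u) (hv : 0 < v)
    (hf : IntegrableOn (fun s => abelKernel (u + v) (T - s) * f s) (Ioi 0)) :
    abelIntegral u (abelIntegral v f) T = abelIntegral (u + v) f T := by
  have hint : Integrable
      (Function.uncurry fun t s => abelKernel u (T - t) * (abelKernel v (t - s) * f s))
      ((volume.restrict (Ioi 0)).prod (volume.restrict (Ioi 0))) := by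
    refine (integrable_prod_iff' (aestronglyMeasurable_semigroup_integrand hu hv hf)).2 ⟨?_, ?_⟩
    · refine Eventually.of_forall fun s => ?_
      have h := ((integrable_abelKernel_mul hu hv s T).mul_const (f s)).integrableOn (s := Ioi 0)
      simpa only [mul_assoc, IntegrableOn] using h
    · refine hf.norm.congr ?_
      filter_upwards [ae_restrict_mem measurableSet_Ioi] with s hs
      simp only [norm_mul, Real.norm_of_nonneg, abelKernel_nonneg hu,
        abelKernel_nonneg hv, abelKernel_nonneg (add_pos hu hv), ← mul_assoc]
      rw [integral_mul_const, setIntegral_abelKernel_mul hu hv (le_of_lt hs)]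
  calc abelIntegral u (abelIntegral v f) T
      = ∫ t in Ioi 0, ∫ s in Ioi 0, abelKernel u (T - t) * (abelKernel v (t - s) * f s) := by
        simp only [abelIntegral, integral_const_mul]
    _ = ∫ s in Ioi 0, ∫ t in Ioi 0, abelKernel u (T - t) * (abelKernel v (t - s) * f s) :=
        integral_integral_swap hint
    _ = abelIntegral (u + v) f T := by
        refine setIntegral_congr_fun measurableSet_Ioi fun s hs => ?_
        simp only [← mul_assoc]
        rw [integral_mul_const, setIntegral_abelKernel_mul hu hv (le_of_lt hs)]

end AbelIntegral

section MittagLeffler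

variable {β b s t T u v : ℝ}

/-- The two-parameter Mittag-Leffler function `E_{β,v}(z) = ∑_j z^j / Γ(βj + v)`. -/
def mittagLeffler (β v z : ℝ) : ℝ := ∑' j : ℕ, z ^ j / Real.Gamma (β * j + v)

/-- The kernel `∑_j b^j s^(βj + v - 1) / Γ(βj + v) = s^(v - 1) E_{β,v}(b s^β)` for `s > 0`, extended
by `0` to `s ≤ 0`: the convolution of the Abel kernel of order `v` with the resolvent of `b` times
the Abel kernel of order `β`. -/
def mittagLefflerKernel (β v b s : ℝ) : ℝ := ∑' j : ℕ, b ^ j * abelKernel (β * j + v) s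

theorem rpow_mul_exp_neg_le_Gamma {R x : ℝ} (hR : 0 < R) (hx : 1 ≤ x) :
    R ^ (x - 1) * Real.exp (-R) ≤ Real.Gamma x := by
  have hint : IntegrableOn (fun t : ℝ => Real.exp (-t) * t ^ (x - 1)) (Ioi 0) :=
    Real.GammaIntegral_convergent (by linarith)
  rw [Real.Gamma_eq_integral (by linarith), ← integral_exp_neg_Ioi, ← integral_const_mul]
  calc ∫ t in Ioi R, R ^ (x - 1) * Real.exp (-t)
      ≤ ∫ t in Ioi R, Real.exp (-t) * t ^ (x - 1) := by
        refine setIntegral_mono_on ((integrableOn_exp_neg_Ioi R).const_mul _)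
          (hint.mono_set (Ioi_subset_Ioi hR.le)) measurableSet_Ioi fun t ht => ?_
        rw [mul_comm]
        have : R ≤ t := le_of_lt ht
        gcongr
    _ ≤ ∫ t in Ioi 0, Real.exp (-t) * t ^ (x - 1) := by
        refine setIntegral_mono_set hint ?_ (Ioi_subset_Ioi hR.le).eventuallyLE
        filter_upwards [ae_restrict_mem measurableSet_Ioi] with t ht
        exact mul_nonneg (Real.exp_pos _).le (Real.rpow_nonneg (le_of_lt ht) _)

theorem norm_pow_div_Gamma_le {R z : ℝ} {j : ℕ} (hR : 0 < R) (hx : 1 ≤ β * j + v)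
    (hz : 2 * |z| ≤ R ^ β) :
    ‖z ^ j / Real.Gamma (β * j + v)‖ ≤ Real.exp R / R ^ (v - 1) * (1 / 2) ^ j := by
  have hΓ : 0 < Real.Gamma (β * j + v) := Real.Gamma_pos_of_pos (by linarith)
  have hbound : (R ^ β) ^ j * R ^ (v - 1) * Real.exp (-R) ≤ Real.Gamma (β * j + v) := by
    rw [← Real.rpow_mul_natCast hR.le, ← Real.rpow_add hR, ← add_sub_assoc]
    exact rpow_mul_exp_neg_le_Gamma hR hx
  have : 0 < R ^ (v - 1) := Real.rpow_pos_of_pos hR _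
  have hcancel : Real.exp R / R ^ (v - 1) * (1 / 2) ^ j *
      ((R ^ β) ^ j * R ^ (v - 1) * Real.exp (-R)) = (R ^ β / 2) ^ j := by
    rw [Real.exp_neg, div_pow, div_pow, one_pow]
    field_simp
  rw [norm_div, norm_pow, Real.norm_eq_abs, Real.norm_of_nonneg hΓ.le, div_le_iff₀ hΓ]
  calc |z| ^ j ≤ (R ^ β / 2) ^ j := by gcongr; linarith
    _ = _ := hcancel.symm
    _ ≤ _ := by gcongr

theorem summable_norm_mittagLeffler (hβ : 0 < β) (v z : ℝ) :
    Summable fun j : ℕ => ‖z ^ j / Real.Gamma (β * j + v)‖ := by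
  let R : ℝ := (2 * |z| + 1) ^ β⁻¹
  have hR : 0 < R := by positivity
  have hz : 2 * |z| ≤ R ^ β := by
    rw [Real.rpow_inv_rpow (by positivity) hβ.ne']
    linarith
  have hlarge : ∀ᶠ j : ℕ in atTop, 1 ≤ β * j + v :=
    (tendsto_atTop_add_const_right atTop v
      (tendsto_natCast_atTop_atTop.const_mul_atTop hβ)).eventually_ge_atTop 1
  refine Summable.of_norm_bounded_eventually_nat
    (summable_geometric_two.mul_left (Real.exp R / R ^ (v - 1))) ?_
  filter_upwards [hlarge] with j hj
  rw [norm_norm]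
  exact norm_pow_div_Gamma_le hR hj hz

theorem summable_mittagLeffler (hβ : 0 < β) (v z : ℝ) :
    Summable fun j : ℕ => z ^ j / Real.Gamma (β * j + v) :=
  (summable_norm_mittagLeffler hβ v z).of_norm

theorem continuous_mittagLeffler (hβ : 0 < β) (v : ℝ) : Continuous (mittagLeffler β v) := by
  refine continuous_iff_continuousAt.2 fun z => ?_
  have h : ContinuousOn (mittagLeffler β v) (Metric.ball 0 (|z| + 1)) := by
    refine continuousOn_tsum (fun j => by fun_prop)
      (summable_norm_mittagLeffler hβ v (|z| + 1)) fun j w hw => ?_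
    rw [norm_div, norm_div, norm_pow, norm_pow,
      Real.norm_of_nonneg (show 0 ≤ |z| + 1 by positivity)]
    have := (mem_ball_zero_iff.1 hw).le
    gcongr
  exact h.continuousAt (Metric.isOpen_ball.mem_nhds (by simp))

theorem mittagLeffler_eq_add (hβ : 0 < β) (v z : ℝ) :
    mittagLeffler β v z = 1 / Real.Gamma v + z * mittagLeffler β (v + β) z := by
  simp only [mittagLeffler]
  rw [(summable_mittagLeffler hβ v z).tsum_eq_zero_add, ← tsum_mul_left]
  congr 1
  · simp
  · refine tsum_congr fun j => ?_
    rw [pow_succ', mul_div_assoc, show β * (j + 1 : ℕ) + v = β * j + (v + β) by push_cast; ring]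

theorem mittagLeffler_zero (hβ : 0 < β) (v : ℝ) : mittagLeffler β v 0 = 1 / Real.Gamma v := by
  rw [mittagLeffler_eq_add hβ, zero_mul, add_zero]

theorem pow_mul_abelKernel (hs : 0 < s) (β v b : ℝ) (j : ℕ) :
    b ^ j * abelKernel (β * j + v) s =
      s ^ (v - 1) * ((b * s ^ β) ^ j / Real.Gamma (β * j + v)) := by
  rw [abelKernel_of_pos _ hs, add_sub_assoc, Real.rpow_add hs, Real.rpow_mul_natCast hs.le, mul_pow]
  ring

theorem mittagLefflerKernel_of_pos (hs : 0 < s) (β v b : ℝ) :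
    mittagLefflerKernel β v b s = s ^ (v - 1) * mittagLeffler β v (b * s ^ β) := by
  simp only [mittagLefflerKernel, mittagLeffler, pow_mul_abelKernel hs, tsum_mul_left]

theorem mittagLefflerKernel_one (hs : 0 < s) (β b : ℝ) :
    mittagLefflerKernel β 1 b s = mittagLeffler β 1 (b * s ^ β) := by
  rw [mittagLefflerKernel_of_pos hs, sub_self, Real.rpow_zero, one_mul]

theorem summable_mittagLefflerKernel (hβ : 0 < β) (v b s : ℝ) :
    Summable fun j : ℕ => b ^ j * abelKernel (β * j + v) s := by
  rcases le_or_gt s 0 with hs | hs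
  · simpa only [abelKernel_of_nonpos _ hs, mul_zero] using summable_zero
  · simpa only [pow_mul_abelKernel hs] using (summable_mittagLeffler hβ v _).mul_left _

theorem mittagLefflerKernel_eq_abelKernel_mul (hv : 0 < v) (hs : 0 < s) (β b : ℝ) :
    mittagLefflerKernel β v b s =
      abelKernel v s * (Real.Gamma v * mittagLeffler β v (b * s ^ β)) := by
  have hΓ : Real.Gamma v ≠ 0 := (Real.Gamma_pos_of_pos hv).ne'
  rw [mittagLefflerKernel_of_pos hs, abelKernel_of_pos v hs]
  field_simp

theorem continuous_mittagLeffler_mul_rpow (hβ : 0 < β) (v b : ℝ) :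
    Continuous fun s : ℝ => mittagLeffler β v (b * s ^ β) :=
  (continuous_mittagLeffler hβ v).comp
    (continuous_const.mul (Real.continuous_rpow_const hβ.le))

theorem continuousOn_mittagLefflerKernel (hβ : 0 < β) (v b : ℝ) :
    ContinuousOn (mittagLefflerKernel β v b) (Ioi 0) :=
  ((continuousOn_id.rpow_const fun _ hs => Or.inl (ne_of_gt hs)).mul
    (continuous_mittagLeffler_mul_rpow hβ v b).continuousOn).congr
    fun _ hs => mittagLefflerKernel_of_pos hs β v b

theorem integrableOn_abelKernel_mul_mittagLefflerKernel (hβ : 0 < β) (hu : 0 < u) (hv : 0 < v)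
    (b T : ℝ) :
    IntegrableOn (fun s => abelKernel u (T - s) * mittagLefflerKernel β v b s) (Ioi 0) :=
  (integrableOn_abelKernel_mul_abelKernel_mul (T := T) hu hv
    ((continuous_mittagLeffler_mul_rpow hβ v b).const_mul (Real.Gamma v)).continuousOn).congr_fun
    (fun s hs => by simp only [mittagLefflerKernel_eq_abelKernel_mul hv hs]) measurableSet_Ioi

theorem abelIntegral_mittagLefflerKernel (hβ : 0 < β) (hu : 0 < u) (hv : 0 < v) (b T : ℝ) :
    abelIntegral u (mittagLefflerKernel β v b) T = mittagLefflerKernel β (u + v) b T := by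
  have hv' (j : ℕ) : 0 < β * j + v := by positivity
  let F : ℕ → ℝ → ℝ := fun j s => b ^ j * (abelKernel u (T - s) * abelKernel (β * j + v) s)
  have hF (j : ℕ) : Integrable (F j) (volume.restrict (Ioi 0)) := by
    have h := (integrable_abelKernel_mul hu (hv' j) 0 T).const_mul (b ^ j)
    simpa only [sub_zero] using (h.integrableOn (s := Ioi 0)).integrable
  have hkernel (j : ℕ) : ∫ s in Ioi 0, abelKernel u (T - s) * abelKernel (β * j + v) s =
      abelKernel (β * j + (u + v)) T := by
    rw [add_left_comm]
    simpa only [sub_zero] using setIntegral_abelKernel_mul hu (hv' j) le_rfl T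
  have hnorm (j : ℕ) : ∫ s in Ioi 0, ‖F j s‖ = |b| ^ j * abelKernel (β * j + (u + v)) T := by
    simp only [F, norm_mul, norm_pow, Real.norm_eq_abs, abs_of_nonneg, abelKernel_nonneg hu,
      abelKernel_nonneg (hv' j)]
    rw [integral_const_mul, hkernel]
  have hsum : Summable fun j => ∫ s in Ioi 0, ‖F j s‖ := by
    simpa only [hnorm] using summable_mittagLefflerKernel hβ (u + v) |b| T
  have h := (hasSum_integral_of_summable_integral_norm hF hsum).tsum_eq
  simp only [F, integral_const_mul, hkernel] at h
  rw [mittagLefflerKernel, h]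
  refine integral_congr_ae (Eventually.of_forall fun s => ?_)
  simp only [mittagLefflerKernel, ← tsum_mul_left, mul_left_comm]

theorem mittagLeffler_eq_one_add (hβ : 0 < β) (b : ℝ) (ht : 0 < t) :
    mittagLeffler β 1 (b * t ^ β) = 1 + b * mittagLefflerKernel β (1 + β) b t := by
  rw [mittagLefflerKernel_of_pos ht, mittagLeffler_eq_add hβ, Real.Gamma_one, div_one,
    add_sub_cancel_left]
  ring

theorem mittagLeffler_volterra (hβ : 0 < β) (b : ℝ) (ht : 0 < t) :
    mittagLeffler β 1 (b * t ^ β) =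
      1 + b * abelIntegral β (fun s => mittagLeffler β 1 (b * s ^ β)) t := by
  rw [← abelIntegral_congr β t fun s hs => mittagLefflerKernel_one hs β b,
    abelIntegral_mittagLefflerKernel hβ hβ one_pos, add_comm β 1, mittagLeffler_eq_one_add hβ b ht]

theorem hasDerivAt_mittagLeffler_mul_rpow (hβ : 0 < β) (b : ℝ) (ht : 0 < t) :
    HasDerivAt (fun s => mittagLeffler β 1 (b * s ^ β)) (b * mittagLefflerKernel β β b t) t := by
  have hcont := continuousOn_mittagLefflerKernel hβ β b
  have hint : IntervalIntegrable (mittagLefflerKernel β β b) volume 0 t :=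
    (intervalIntegrable_iff_integrableOn_Ioc_of_le ht.le).2 <|
      integrableOn_abelKernel_one_mul_iff.1 <|
        integrableOn_abelKernel_mul_mittagLefflerKernel hβ one_pos hβ b t
  have hFTC := intervalIntegral.integral_hasDerivAt_right hint
    (hcont.stronglyMeasurableAtFilter isOpen_Ioi t ht) (hcont.continuousAt (Ioi_mem_nhds ht))
  refine ((hFTC.const_mul b).const_add 1).congr_of_eventuallyEq ?_
  filter_upwards [Ioi_mem_nhds ht] with s hs
  rw [mittagLeffler_eq_one_add hβ b hs, ← abelIntegral_mittagLefflerKernel hβ one_pos hβ,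
    abelIntegral_one (le_of_lt hs)]

theorem abs_le_of_volterra {d : ℝ → ℝ} {M : ℝ} (hβ : 0 < β) (hM : ∀ t ∈ Ioc 0 T, |d t| ≤ M)
    (hd : ∀ t ∈ Ioc 0 T, d t = b * abelIntegral β d t) (n : ℕ) :
    ∀ t ∈ Ioc 0 T, |d t| ≤ M * |b| ^ n * abelKernel (β * n + 1) t := by
  induction n with
  | zero => intro t ht; simpa [abelKernel_one ht.1] using hM t ht
  | succ n ih =>
    intro t ht
    have hn : 0 < β * n + 1 := by positivity
    have hconv := setIntegral_abelKernel_mul hβ hn le_rfl t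
    have hint := (integrable_abelKernel_mul hβ hn 0 t).integrableOn (s := Ioi 0)
    simp only [sub_zero] at hconv hint
    have hle : |abelIntegral β d t| ≤
        ∫ s in Ioi 0, M * |b| ^ n * (abelKernel β (t - s) * abelKernel (β * n + 1) s) := by
      rw [← Real.norm_eq_abs, abelIntegral]
      refine norm_integral_le_of_norm_le (hint.const_mul _) ?_
      filter_upwards [ae_restrict_mem measurableSet_Ioi] with s hs
      rw [norm_mul, Real.norm_of_nonneg (abelKernel_nonneg hβ _), mul_left_comm]
      rcases le_or_gt t s with hts | hts
      · simp only [abelKernel_of_nonpos β (sub_nonpos.2 hts), zero_mul, le_refl]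
      · exact mul_le_mul_of_nonneg_left (ih s ⟨hs, hts.le.trans ht.2⟩) (abelKernel_nonneg hβ _)
    rw [integral_const_mul, hconv] at hle
    rw [hd t ht, abs_mul, show β * (n + 1 : ℕ) + 1 = β + (β * n + 1) by push_cast; ring]
    calc |b| * |abelIntegral β d t|
        ≤ |b| * (M * |b| ^ n * abelKernel (β + (β * n + 1)) t) := by gcongr
      _ = M * |b| ^ (n + 1) * abelKernel (β + (β * n + 1)) t := by ring

theorem eq_zero_of_volterra {d : ℝ → ℝ} {M : ℝ} (hβ : 0 < β) (hM : ∀ t ∈ Ioc 0 T, |d t| ≤ M)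
    (hd : ∀ t ∈ Ioc 0 T, d t = b * abelIntegral β d t) (ht : t ∈ Ioc 0 T) : d t = 0 := by
  have hlim := ((summable_mittagLefflerKernel hβ 1 |b| t).tendsto_atTop_zero).const_mul M
  simp only [mul_zero, ← mul_assoc] at hlim
  exact abs_nonpos_iff.1 <| ge_of_tendsto' hlim fun n => abs_le_of_volterra hβ hM hd n t ht

theorem eq_mul_mittagLeffler_of_volterra {h : ℝ → ℝ} {c : ℝ} (hβ : 0 < β)
    (hc : ContinuousOn h (Icc 0 T)) (heq : ∀ t ∈ Ioc 0 T, h t = c + b * abelIntegral β h t)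
    (ht : t ∈ Ioc 0 T) : h t = c * mittagLeffler β 1 (b * t ^ β) := by
  have hE := continuous_mittagLeffler_mul_rpow hβ 1 b
  let d : ℝ → ℝ := fun t => h t - c * mittagLeffler β 1 (b * t ^ β)
  have hdc : ContinuousOn d (Icc 0 T) := hc.sub (hE.const_mul c).continuousOn
  obtain ⟨M, hM⟩ := isCompact_Icc.exists_bound_of_continuousOn hdc
  refine sub_eq_zero.1 <| eq_zero_of_volterra (d := d) (b := b) hβ
    (fun t ht => hM t (Ioc_subset_Icc_self ht)) (fun t ht => ?_) ht
  have hsub : abelIntegral β d t = abelIntegral β h t -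
      c * abelIntegral β (fun s => mittagLeffler β 1 (b * s ^ β)) t := by
    rw [← abelIntegral_const_mul]
    exact abelIntegral_sub
      (integrableOn_abelKernel_mul_of_continuousOn hβ (hc.mono (Icc_subset_Icc_right ht.2)))
      (integrableOn_abelKernel_mul_of_continuousOn hβ (hE.const_mul c).continuousOn)
  calc d t = h t - c * mittagLeffler β 1 (b * t ^ β) := rfl
    _ = b * abelIntegral β d t := by
      rw [hsub, heq t ht, mittagLeffler_volterra hβ b ht.1]
      ring

theorem eq_mul_mittagLeffler_of_caputo {h h' : ℝ → ℝ} {C : Set ℝ} (hβ : 0 < β) (hβ' : β < 1)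
    (hC : C.Countable) (hc : ContinuousOn h (Icc 0 T))
    (hd : ∀ s ∈ Ioo 0 T \ C, HasDerivAt h (h' s) s)
    (hint : ∀ t ∈ Ioc 0 T, IntegrableOn (fun s => abelKernel (1 - β) (t - s) * h' s) (Ioi 0))
    (heq : ∀ t ∈ Ioc 0 T, abelIntegral (1 - β) h' t = b * h t) (ht : t ∈ Icc 0 T) :
    h t = h 0 * mittagLeffler β 1 (b * t ^ β) := by
  have hβ1 : 0 < 1 - β := sub_pos.2 hβ'
  rcases ht.1.eq_or_lt with rfl | ht0
  · rw [Real.zero_rpow hβ.ne', mul_zero, mittagLeffler_zero hβ, Real.Gamma_one, div_one, mul_one]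
  refine eq_mul_mittagLeffler_of_volterra hβ hc (fun t ht => ?_) ⟨ht0, ht.2⟩
  have hint1 : IntegrableOn (fun s => abelKernel 1 (t - s) * h' s) (Ioi 0) :=
    integrableOn_abelKernel_mul_of_le hβ1 (by linarith) (hint t ht)
  have hFTC : abelIntegral 1 h' t = h t - h 0 := by
    rw [abelIntegral_one ht.1.le]
    exact integral_eq_of_hasDerivAt_off_countable_of_le h h' ht.1.le hC
      (hc.mono (Icc_subset_Icc_right ht.2))
      (fun s hs => hd s ⟨Ioo_subset_Ioo_right ht.2 hs.1, hs.2⟩)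
      ((intervalIntegrable_iff_integrableOn_Ioc_of_le ht.1.le).2
        (integrableOn_abelKernel_one_mul_iff.1 hint1))
  have hsemigroup : abelIntegral β (abelIntegral (1 - β) h') t = abelIntegral 1 h' t := by
    rw [abelIntegral_abelIntegral hβ hβ1 (by rwa [add_sub_cancel]), add_sub_cancel]
  have hcaputo : abelIntegral β (abelIntegral (1 - β) h') t = b * abelIntegral β h t := by
    rw [← abelIntegral_const_mul, abelIntegral_eq_setIntegral_Ioc, abelIntegral_eq_setIntegral_Ioc]
    exact setIntegral_congr_fun measurableSet_Ioc fun s hs => by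
      simp only [heq s ⟨hs.1, hs.2.trans ht.2⟩]
  linarith

end MittagLeffler

section Clock

variable {S p : ℝ → ℝ} {a b s t x : ℝ}

theorem notMem_pointsOfChange_of_monotone {f : ℝ → ℝ} (hf : Monotone f) (h : f a = f b)
    (hx : x ∈ Ioo a b) : x ∉ pointsOfChange f := by
  have hconst : ∀ y ∈ Ioo a b, f y = f a := fun y hy =>
    le_antisymm ((hf hy.2.le).trans h.ge) (hf hy.1.le)
  intro hchange
  obtain ⟨y, hy, z, hz, hne⟩ := hchange a b hx.1 hx.2
  exact hne ((hconst y hy).trans (hconst z hz).symm)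

theorem eventually_eq_of_notMem_pointsOfChange {f : ℝ → ℝ} (hx : x ∉ pointsOfChange f) :
    ∀ᶠ y in 𝓝 x, f y = f x := by
  simp only [pointsOfChange, mem_ofPred_eq, not_forall] at hx
  obtain ⟨c, d, hc, hd, h⟩ := hx
  filter_upwards [Ioo_mem_nhds hc hd] with y hy
  by_contra hne
  exact h ⟨y, hy, x, ⟨hc, hd⟩, hne⟩

theorem eventually_apply_ne_of_monotone {f : ℝ → ℝ} (hf : Monotone f) (x : ℝ) :
    ∀ᶠ y in 𝓝[pointsOfChange f \ {x}] x, f y ≠ f x := by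
  have hright : ∀ᶠ y in 𝓝[>] x, y ∈ pointsOfChange f → f y ≠ f x := by
    by_contra h
    simp only [not_eventually, Classical.not_imp, not_not] at h
    obtain ⟨d, ⟨-, hd⟩, hxd⟩ := (h.and_eventually self_mem_nhdsWithin).exists
    obtain ⟨y, ⟨hy, -⟩, hyd⟩ := (h.and_eventually (Ioo_mem_nhdsGT hxd)).exists
    exact notMem_pointsOfChange_of_monotone hf hd.symm hyd hy
  have hleft : ∀ᶠ y in 𝓝[<] x, y ∈ pointsOfChange f → f y ≠ f x := by
    by_contra h
    simp only [not_eventually, Classical.not_imp, not_not] at h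
    obtain ⟨c, ⟨-, hc⟩, hcx⟩ := (h.and_eventually self_mem_nhdsWithin).exists
    obtain ⟨y, ⟨hy, -⟩, hyc⟩ := (h.and_eventually (Ioo_mem_nhdsLT hcx)).exists
    exact notMem_pointsOfChange_of_monotone hf hc hyc hy
  have hne : ∀ᶠ y in 𝓝[≠] x, y ∈ pointsOfChange f → f y ≠ f x := by
    rw [← Iio_union_Ioi, nhdsWithin_union]
    exact eventually_sup.2 ⟨hleft, hright⟩
  filter_upwards [nhdsWithin_mono x (fun y hy => hy.2) hne, self_mem_nhdsWithin]
    with y hy hyF using hy hyF.1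

theorem continuousOn_image_of_continuousOn_comp {X Y Z : Type*} [TopologicalSpace X]
    [TopologicalSpace Y] [T2Space Y] [TopologicalSpace Z] {f : X → Y} {g : Y → Z} {K : Set X}
    (hK : IsCompact K) (hf : ContinuousOn f K) (hgf : ContinuousOn (g ∘ f) K) :
    ContinuousOn g (f '' K) := by
  refine continuousOn_iff_isClosed.2 fun C hC => ?_
  obtain ⟨D, hD, hCD⟩ := continuousOn_iff_isClosed.1 hgf C hC
  refine ⟨f '' (D ∩ K), ((hK.inter_left hD).image_of_continuousOn
    (hf.mono inter_subset_right)).isClosed, ?_⟩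
  rw [← hCD, preimage_comp, inter_comm (f ⁻¹' _), image_inter_preimage, inter_comm,
    inter_right_comm, inter_self]

/-- The properties of the staircase function of an `α`-perfect set that allow it to be used as a new
time coordinate on `[0, ∞)`. -/
structure IsClock (S : ℝ → ℝ) : Prop where
  mono : Monotone S
  cont : Continuous S
  zero : S 0 = 0
  top : Tendsto S atTop atTop

/-- The last time at which the clock `S` shows `s ≥ 0`, a right inverse of `S` on `[0, ∞)`. The
value `s` at `s < 0` makes it strictly increasing on all of `ℝ`, hence a measurable embedding. -/
def lastTime (S : ℝ → ℝ) (s : ℝ) : ℝ := if 0 ≤ s then sSup {t | S t ≤ s} else s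

theorem lastTime_of_neg (S : ℝ → ℝ) (hs : s < 0) : lastTime S s = s := if_neg hs.not_ge

theorem nonneg_of_lastTime_nonneg (h : 0 ≤ lastTime S s) : 0 ≤ s := by
  by_contra! hs
  exact (h.trans_eq (lastTime_of_neg S hs)).not_gt hs

namespace IsClock

theorem apply_nonneg (hS : IsClock S) (ht : 0 ≤ t) : 0 ≤ S t := hS.zero ▸ hS.mono ht

theorem pos_of_apply_pos (hS : IsClock S) (ht : 0 < S t) : 0 < t :=
  hS.mono.reflect_lt (hS.zero.trans_lt ht)

theorem le_lastTime_iff (hS : IsClock S) (hs : 0 ≤ s) : t ≤ lastTime S s ↔ S t ≤ s := by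
  have hne : {t | S t ≤ s}.Nonempty := ⟨0, hS.zero.trans_le hs⟩
  have hbdd : BddAbove {t | S t ≤ s} := by
    obtain ⟨b, hb⟩ := (hS.top.eventually_gt_atTop s).exists
    exact ⟨b, fun t ht => (hS.mono.reflect_lt (lt_of_le_of_lt ht hb)).le⟩
  rw [lastTime, if_pos hs]
  exact ⟨fun h => (hS.mono h).trans ((isClosed_le hS.cont continuous_const).csSup_mem hne hbdd),
    fun h => le_csSup hbdd h⟩

theorem lastTime_lt_iff (hS : IsClock S) (hs : 0 ≤ s) : lastTime S s < t ↔ s < S t := by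
  rw [← not_le, hS.le_lastTime_iff hs, not_le]

theorem lastTime_nonneg (hS : IsClock S) (hs : 0 ≤ s) : 0 ≤ lastTime S s :=
  (hS.le_lastTime_iff hs).2 (hS.zero.trans_le hs)

theorem apply_lastTime (hS : IsClock S) (hs : 0 ≤ s) : S (lastTime S s) = s := by
  obtain ⟨b, hb⟩ := (hS.top.eventually_ge_atTop s).exists
  obtain ⟨t, rfl⟩ : s ∈ range S :=
    mem_range_of_exists_le_of_exists_ge hS.cont ⟨0, hS.zero.trans_le hs⟩ ⟨b, hb⟩
  exact le_antisymm ((hS.le_lastTime_iff hs).1 le_rfl)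
    (hS.mono ((hS.le_lastTime_iff hs).2 le_rfl))

theorem le_lastTime_apply (hS : IsClock S) (ht : 0 ≤ t) : t ≤ lastTime S (S t) :=
  (hS.le_lastTime_iff (hS.apply_nonneg ht)).2 le_rfl

theorem strictMono_lastTime (hS : IsClock S) : StrictMono (lastTime S) := by
  intro s s' h
  rcases le_or_gt 0 s with hs | hs
  · rwa [hS.lastTime_lt_iff hs, hS.apply_lastTime (hs.trans h.le)]
  · rw [lastTime_of_neg S hs]
    rcases le_or_gt 0 s' with hs' | hs'
    · exact hs.trans_le (hS.lastTime_nonneg hs')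
    · rwa [lastTime_of_neg S hs']

theorem lastTime_pos (hS : IsClock S) (hs : 0 < s) : 0 < lastTime S s :=
  (hS.lastTime_nonneg le_rfl).trans_lt (hS.strictMono_lastTime hs)

theorem measurableEmbedding_lastTime (hS : IsClock S) : MeasurableEmbedding (lastTime S) :=
  hS.strictMono_lastTime.monotone.measurable.measurableEmbedding hS.strictMono_lastTime.injective

theorem lastTime_mem_pointsOfChange (hS : IsClock S) (hs : 0 ≤ s) :
    lastTime S s ∈ pointsOfChange S := by
  intro c d hc hd
  obtain ⟨z, hz, hzd⟩ := exists_between hd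
  refine ⟨lastTime S s, ⟨hc, hd⟩, z, ⟨hc.trans hz, hzd⟩, ?_⟩
  rw [hS.apply_lastTime hs]
  exact ((hS.lastTime_lt_iff hs).1 hz).ne

theorem exists_mem_pointsOfChange_Ioo (hS : IsClock S) (ha : 0 ≤ a) (hab : S a < S b) :
    ∃ z ∈ Ioo a b, z ∈ pointsOfChange S := by
  obtain ⟨s, has, hsb⟩ := exists_between hab
  have hs : 0 ≤ s := (hS.apply_nonneg ha).trans has.le
  refine ⟨lastTime S s, ⟨hS.mono.reflect_lt ?_, (hS.lastTime_lt_iff hs).2 hsb⟩,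
    hS.lastTime_mem_pointsOfChange hs⟩
  rwa [hS.apply_lastTime hs]

theorem nhdsWithin_pointsOfChange_neBot (hS : IsClock S) (hx : x ∈ pointsOfChange S)
    (hpos : 0 < S x) : (𝓝[pointsOfChange S \ {x}] x).NeBot := by
  refine mem_closure_iff_nhdsWithin_neBot.1 (mem_closure_iff_nhds.2 fun U hU => ?_)
  obtain ⟨c, d, ⟨hc, hd⟩, hcd⟩ := mem_nhds_iff_exists_Ioo_subset.1 hU
  have hx0 := hS.pos_of_apply_pos hpos
  obtain ⟨y, hy, w, hw, hyw⟩ : ∃ y ∈ Ioo (max c 0) d, ∃ w ∈ Ioo (max c 0) d, S y < S w := by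
    obtain ⟨y, hy, w, hw, hne⟩ := hx (max c 0) d (max_lt hc hx0) hd
    exact hne.lt_or_gt.elim (fun h => ⟨y, hy, w, hw, h⟩) fun h => ⟨w, hw, y, hy, h⟩
  have hcy := max_lt_iff.1 hy.1
  rcases lt_or_ge (S y) (S x) with h | h
  · obtain ⟨z, hz, hzP⟩ := hS.exists_mem_pointsOfChange_Ioo hcy.2.le h
    exact ⟨z, hcd ⟨hcy.1.trans hz.1, hz.2.trans hd⟩, hzP, hz.2.ne⟩
  · obtain ⟨z, hz, hzP⟩ := hS.exists_mem_pointsOfChange_Ioo hx0.le (h.trans_lt hyw)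
    exact ⟨z, hcd ⟨hc.trans hz.1, hz.2.trans hw.2⟩, hzP, hz.1.ne'⟩

theorem continuousOn_comp_lastTime (hS : IsClock S) (ht : 0 ≤ t) (hp : ContinuousOn p (Icc 0 t))
    (hpS : ∀ u ∈ Icc 0 t, p (lastTime S (S u)) = p u) :
    ContinuousOn (fun s => p (lastTime S s)) (Icc 0 (S t)) := by
  have himage : Icc (S 0) (S t) ⊆ S '' Icc 0 t :=
    intermediate_value_Icc ht hS.cont.continuousOn
  rw [hS.zero] at himage
  exact (continuousOn_image_of_continuousOn_comp (g := fun s => p (lastTime S s)) isCompact_Icc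
    hS.cont.continuousOn (hp.congr hpS)).mono himage

theorem lastTime_preimage_Ioc_ae_eq (hS : IsClock S) (ha : 0 ≤ a) (b : ℝ) :
    lastTime S ⁻¹' Ioc a b =ᵐ[volume] Ioc (S a) (S b) := by
  have hle : lastTime S ⁻¹' Ioc a b ⊆ Icc (S a) (S b) := fun s hs => by
    have h := hS.apply_lastTime (nonneg_of_lastTime_nonneg (ha.trans (le_of_lt hs.1)))
    exact ⟨h ▸ hS.mono hs.1.le, h ▸ hS.mono hs.2⟩
  have hge : Ioo (S a) (S b) ⊆ lastTime S ⁻¹' Ioc a b := fun s hs => by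
    have hs0 : 0 ≤ s := (hS.apply_nonneg ha).trans hs.1.le
    refine ⟨hS.mono.reflect_lt ?_, ((hS.lastTime_lt_iff hs0).2 hs.2).le⟩
    simpa only [hS.apply_lastTime hs0] using hs.1
  exact (hle.eventuallyLE.trans Ioc_ae_eq_Icc.symm.le).antisymm
    (Ioo_ae_eq_Ioc.symm.le.trans hge.eventuallyLE)

theorem lastTime_preimage_Ioi_ae_eq (hS : IsClock S) :
    lastTime S ⁻¹' Ioi 0 =ᵐ[volume] Ioi 0 := by
  have hle : lastTime S ⁻¹' Ioi 0 ⊆ Ici 0 := fun s hs =>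
    nonneg_of_lastTime_nonneg (S := S) (le_of_lt hs)
  have hge : Ioi 0 ⊆ lastTime S ⁻¹' Ioi 0 := fun s hs => hS.lastTime_pos hs
  exact (hle.eventuallyLE.trans Ioi_ae_eq_Ici.symm.le).antisymm hge.eventuallyLE

theorem stieltjesFunction_measure_Ioc (hS : IsClock S) (a b : ℝ) :
    hS.mono.stieltjesFunction.measure (Ioc a b) = ENNReal.ofReal (S b - S a) := by
  rw [StieltjesFunction.measure_Ioc, hS.mono.stieltjesFunction_eq, hS.mono.stieltjesFunction_eq,
    hS.cont.continuousWithinAt.rightLim_eq, hS.cont.continuousWithinAt.rightLim_eq]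

theorem restrict_map_lastTime_Ioi (hS : IsClock S) :
    (volume.map (lastTime S)).restrict (Ioi 0) =
      hS.mono.stieltjesFunction.measure.restrict (Ioi 0) := by
  symm
  refine Measure.ext_of_Ioc _ _ fun a b _ => ?_
  rw [Measure.restrict_apply measurableSet_Ioc, Measure.restrict_apply measurableSet_Ioc,
    Ioc_inter_Ioi, hS.stieltjesFunction_measure_Ioc,
    Measure.map_apply hS.measurableEmbedding_lastTime.measurable measurableSet_Ioc,
    measure_congr (hS.lastTime_preimage_Ioc_ae_eq (le_max_right a 0) b), Real.volume_Ioc]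

theorem map_lastTime_restrict (hS : IsClock S) {A B : Set ℝ} (hA : MeasurableSet A)
    (hA0 : A ⊆ Ioi 0) (hAB : lastTime S ⁻¹' A =ᵐ[volume] B) :
    (volume.restrict B).map (lastTime S) = hS.mono.stieltjesFunction.measure.restrict A := by
  rw [← Measure.restrict_congr_set hAB,
    ← Measure.restrict_map hS.measurableEmbedding_lastTime.measurable hA, ← inter_eq_left.2 hA0,
    ← Measure.restrict_restrict hA, ← Measure.restrict_restrict hA, hS.restrict_map_lastTime_Ioi]

theorem map_lastTime_restrict_Ioi (hS : IsClock S) :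
    (volume.restrict (Ioi 0)).map (lastTime S) =
      hS.mono.stieltjesFunction.measure.restrict (Ioi 0) :=
  hS.map_lastTime_restrict measurableSet_Ioi Subset.rfl hS.lastTime_preimage_Ioi_ae_eq

theorem map_lastTime_restrict_Ioc (hS : IsClock S) (x : ℝ) :
    (volume.restrict (Ioc 0 (S x))).map (lastTime S) =
      hS.mono.stieltjesFunction.measure.restrict (Ioc 0 x) :=
  hS.map_lastTime_restrict measurableSet_Ioc Ioc_subset_Ioi_self
    (by simpa only [hS.zero] using hS.lastTime_preimage_Ioc_ae_eq le_rfl x)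

end IsClock

end Clock

section FractalCaputo

variable {F : Set ℝ} {α β a k p₀ s t x l : ℝ} {p G : ℝ → ℝ}

theorem IsAlphaPerfect.isClock (hα : 0 < α) (hF : IsAlphaPerfect F α)
    (hS : Tendsto (staircase F α) atTop atTop) : IsClock (staircase F α) where
  mono := staircase_monotone hα hF.mass_ne_top
  cont := staircase_continuous hα hF.mass_ne_top
  zero := staircase_zero F α
  top := hS

theorem fractalMeasure_eq (hS : IsClock (staircase F α)) :
    fractalMeasure F α = hS.mono.stieltjesFunction.measure :=
  dif_pos hS.mono

theorem fractalGamma_eq (hS : IsClock (staircase F α)) (hx : 0 < x) :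
    fractalGamma F α x = Real.Gamma x := by
  rw [fractalGamma, fractalMeasure_eq hS, ← hS.map_lastTime_restrict_Ioi,
    hS.measurableEmbedding_lastTime.integral_map, Real.Gamma_eq_integral hx]
  exact setIntegral_congr_fun measurableSet_Ioi fun s hs => by
    simp only [hS.apply_lastTime (le_of_lt hs)]

theorem mittagLefflerTerm_eq (hS : IsClock (staircase F α)) (hβ : 0 < β) (z : ℝ) :
    mittagLefflerTerm F α β 1 z = fun j : ℕ => z ^ j / Real.Gamma (β * j + 1) := by
  ext j
  rw [mittagLefflerTerm, fractalGamma_eq hS (by positivity)]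

theorem fractalMittagLeffler_eq (hS : IsClock (staircase F α)) (hβ : 0 < β) (z : ℝ) :
    fractalMittagLeffler F α β 1 z = mittagLeffler β 1 z := by
  rw [fractalMittagLeffler, mittagLefflerTerm_eq hS hβ, mittagLeffler]

theorem caputoIntegrand_comp_lastTime_ae_eq (hS : IsClock (staircase F α)) (hβ' : β < 1)
    (p : ℝ → ℝ) (x : ℝ) :
    (fun s => caputoIntegrand F α β p x (lastTime (staircase F α) s))
      =ᵐ[volume.restrict (Ioc 0 (staircase F α x))] fun s => Real.Gamma (1 - β) *
        (abelKernel (1 - β) (staircase F α x - s) *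
          fractalDeriv F α p (lastTime (staircase F α) s)) := by
  have hΓ : Real.Gamma (1 - β) ≠ 0 := (Real.Gamma_pos_of_pos (sub_pos.2 hβ')).ne'
  filter_upwards [ae_restrict_mem measurableSet_Ioc, ae_restrict_Ioc_lt (staircase F α x)]
    with s hs hlt
  rw [caputoIntegrand, hS.apply_lastTime hs.1.le, abelKernel_of_pos _ (sub_pos.2 hlt),
    sub_sub_cancel_left]
  field_simp

theorem caputoExistsAt_iff (hS : IsClock (staircase F α)) (hβ' : β < 1) :
    CaputoExistsAt F α β p x ↔
      IntegrableOn (fun s => abelKernel (1 - β) (staircase F α x - s) *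
        fractalDeriv F α p (lastTime (staircase F α) s)) (Ioi 0) := by
  have hΓ : Real.Gamma (1 - β) ≠ 0 := (Real.Gamma_pos_of_pos (sub_pos.2 hβ')).ne'
  rw [integrableOn_abelKernel_mul_iff (f := fun s => fractalDeriv F α p (lastTime _ s)),
    CaputoExistsAt, IntegrableOn, fractalMeasure_eq hS, ← hS.map_lastTime_restrict_Ioc,
    hS.measurableEmbedding_lastTime.integrable_map_iff]
  exact (integrable_congr (caputoIntegrand_comp_lastTime_ae_eq hS hβ' p x)).trans
    (integrable_const_mul_iff hΓ.isUnit _)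

theorem caputoDeriv_eq (hS : IsClock (staircase F α)) (hβ' : β < 1) (p : ℝ → ℝ) (x : ℝ) :
    caputoDeriv F α β p x = abelIntegral (1 - β)
      (fun s => fractalDeriv F α p (lastTime (staircase F α) s)) (staircase F α x) := by
  have hβ1 : 0 < 1 - β := sub_pos.2 hβ'
  rw [caputoDeriv, fractalGamma_eq hS hβ1, fractalMeasure_eq hS, ← hS.map_lastTime_restrict_Ioc,
    hS.measurableEmbedding_lastTime.integral_map,
    integral_congr_ae (caputoIntegrand_comp_lastTime_ae_eq hS hβ' p x), integral_const_mul,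
    abelIntegral_eq_setIntegral_Ioc, one_div,
    inv_mul_cancel_left₀ (Real.Gamma_pos_of_pos hβ1).ne']

theorem fractalDeriv_eq_of_tendsto (hS : IsClock (staircase F α))
    (hF : pointsOfChange (staircase F α) = F) (hx : x ∈ F) (hpos : 0 < staircase F α x)
    (h : Tendsto (fractalSlope F α p x) (𝓝[F \ {x}] x) (𝓝 l)) : fractalDeriv F α p x = l := by
  have : (𝓝[F \ {x}] x).NeBot := by
    simpa only [hF] using hS.nhdsWithin_pointsOfChange_neBot (hF.ge hx) hpos
  rw [fractalDeriv, if_pos hx, h.limUnder_eq]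

theorem IsPricePath.apply_lastTime (hS : IsClock (staircase F α))
    (hF : pointsOfChange (staircase F α) = F) (hp : IsPricePath F α p) (ht : 0 ≤ t) :
    p (lastTime (staircase F α) (staircase F α t)) = p t := by
  have hle := hS.le_lastTime_apply ht
  have hgap : ∀ x ∈ Ioo t (lastTime (staircase F α) (staircase F α t)), HasDerivAt p 0 x :=
    fun x hx => by
      have hxF : x ∉ F := hF ▸ notMem_pointsOfChange_of_monotone hS.mono
        (hS.apply_lastTime (hS.apply_nonneg ht)).symm hx
      exact (hasDerivAt_const x (p x)).congr_of_eventuallyEq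
        (hp.locallyConstant x (ht.trans_lt hx.1) hxF)
  have hcont : ContinuousOn p (Icc t (lastTime (staircase F α) (staircase F α t))) :=
    hp.continuousOn.mono fun x hx => ht.trans hx.1
  have hFTC := intervalIntegral.integral_eq_sub_of_hasDerivAt_of_le hle hcont hgap
    intervalIntegrable_const
  rw [intervalIntegral.integral_zero] at hFTC
  exact sub_eq_zero.1 hFTC.symm

theorem hasDerivAt_comp_lastTime (hS : IsClock (staircase F α))
    (hF : pointsOfChange (staircase F α) = F) (hp : IsPricePath F α p) (hs : 0 < s)
    (hc : ContinuousAt (lastTime (staircase F α)) s) :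
    HasDerivAt (fun s => p (lastTime (staircase F α) s))
      (fractalDeriv F α p (lastTime (staircase F α) s)) s := by
  have hSs := hS.apply_lastTime hs.le
  have hmem : ∀ r, 0 < r → lastTime (staircase F α) r ∈ F := fun r hr =>
    hF.le (hS.lastTime_mem_pointsOfChange hr.le)
  have hpos : 0 < staircase F α (lastTime (staircase F α) s) := hSs.symm ▸ hs
  obtain ⟨l, hl⟩ := hp.differentiable _ (hmem s hs) hpos
  rw [fractalDeriv_eq_of_tendsto hS hF (hmem s hs) hpos hl, hasDerivAt_iff_tendsto_slope]
  have hnear : ∀ᶠ r in 𝓝[≠] s, 0 < r := mem_nhdsWithin_of_mem_nhds (Ioi_mem_nhds hs)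
  have hlim : Tendsto (lastTime (staircase F α)) (𝓝[≠] s)
      (𝓝[F \ {lastTime (staircase F α) s}] (lastTime (staircase F α) s)) := by
    refine tendsto_nhdsWithin_iff.2 ⟨hc.tendsto.mono_left nhdsWithin_le_nhds, ?_⟩
    filter_upwards [hnear, self_mem_nhdsWithin] with r hr hne
    exact ⟨hmem r hr, hS.strictMono_lastTime.injective.ne hne⟩
  refine (hl.comp hlim).congr' ?_
  filter_upwards [hnear] with r hr
  rw [slope_def_field, Function.comp_apply, fractalSlope, hSs, hS.apply_lastTime hr.le]

theorem tendsto_fractalSlope_of_hasDerivAt (hS : IsClock (staircase F α))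
    (hF : pointsOfChange (staircase F α) = F) (hp : ∀ t, 0 ≤ t → p t = G (staircase F α t))
    (hpos : 0 < staircase F α t) (hG : HasDerivAt G l (staircase F α t)) :
    Tendsto (fractalSlope F α p t) (𝓝[F \ {t}] t) (𝓝 l) := by
  have ht0 := hS.pos_of_apply_pos hpos
  have hne : ∀ᶠ y in 𝓝[F \ {t}] t, staircase F α y ≠ staircase F α t := by
    simpa only [hF] using eventually_apply_ne_of_monotone hS.mono t
  have hlim : Tendsto (staircase F α) (𝓝[F \ {t}] t) (𝓝[≠] (staircase F α t)) :=
    tendsto_nhdsWithin_iff.2 ⟨hS.cont.continuousAt.tendsto.mono_left nhdsWithin_le_nhds, hne⟩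
  refine ((hasDerivAt_iff_tendsto_slope.1 hG).comp hlim).congr' ?_
  filter_upwards [mem_nhdsWithin_of_mem_nhds (Ioi_mem_nhds ht0)] with y hy
  rw [Function.comp_apply, slope_def_field, fractalSlope, hp y (le_of_lt hy), hp t ht0.le]

theorem fractalDeriv_lastTime (hS : IsClock (staircase F α))
    (hF : pointsOfChange (staircase F α) = F) (hp : ∀ t, 0 ≤ t → p t = G (staircase F α t))
    (hs : 0 < s) (hG : HasDerivAt G l s) :
    fractalDeriv F α p (lastTime (staircase F α) s) = l := by
  have hSs := hS.apply_lastTime hs.le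
  have hpos : 0 < staircase F α (lastTime (staircase F α) s) := hSs.symm ▸ hs
  exact fractalDeriv_eq_of_tendsto hS hF (hF.le (hS.lastTime_mem_pointsOfChange hs.le)) hpos
    (tendsto_fractalSlope_of_hasDerivAt hS hF hp hpos (hSs.symm ▸ hG))

theorem isPricePath_of_eq_comp_staircase (hS : IsClock (staircase F α))
    (hF : pointsOfChange (staircase F α) = F) (hp : ∀ t, 0 ≤ t → p t = G (staircase F α t))
    (hGc : ContinuousOn G (Ici 0)) (hG : ∀ s, 0 < s → DifferentiableAt ℝ G s) :
    IsPricePath F α p where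
  continuousOn := (hGc.comp hS.cont.continuousOn fun _ ht => hS.apply_nonneg ht).congr hp
  locallyConstant t ht htF := by
    rw [← hF] at htF
    filter_upwards [eventually_eq_of_notMem_pointsOfChange htF, Ioi_mem_nhds ht] with u hu hu0
    rw [hp u (le_of_lt hu0), hp t ht.le, hu]
  differentiable t _ ht :=
    ⟨_, tendsto_fractalSlope_of_hasDerivAt hS hF hp ht (hG _ ht).hasDerivAt⟩

theorem SolvesCaputo.eq_mittagLeffler (hS : IsClock (staircase F α))
    (hF : pointsOfChange (staircase F α) = F) (hβ : 0 < β) (hβ' : β < 1)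
    (hp : SolvesCaputo F α β a (a * k) p₀ p) (ht : 0 ≤ t) :
    p t = k + (p₀ - k) * mittagLeffler β 1 (-a * staircase F α t ^ β) := by
  have hfiber := fun u hu => hp.path.apply_lastTime hS hF (t := u) hu
  let h : ℝ → ℝ := fun s => p (lastTime (staircase F α) s) - k
  let h' : ℝ → ℝ := fun s => fractalDeriv F α p (lastTime (staircase F α) s)
  have hsurj : ∀ s, 0 ≤ s → ∃ u, 0 ≤ u ∧ staircase F α u = s := fun s hs =>
    ⟨_, hS.lastTime_nonneg hs, hS.apply_lastTime hs⟩
  have happly : ∀ u, 0 ≤ u → h (staircase F α u) = p u - k := fun u hu => by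
    simp only [h, hfiber u hu]
  have hcont : ContinuousOn h (Icc 0 (staircase F α t)) :=
    (hS.continuousOn_comp_lastTime ht (hp.path.continuousOn.mono Icc_subset_Ici_self)
      fun u hu => hfiber u hu.1).sub continuousOn_const
  have hderiv : ∀ s ∈ Ioo 0 (staircase F α t) \ {s | ¬ContinuousAt (lastTime (staircase F α)) s},
      HasDerivAt h (h' s) s := fun s hs =>
    (hasDerivAt_comp_lastTime hS hF hp.path hs.1.1 (not_not.1 hs.2)).sub_const k
  have hint : ∀ s ∈ Ioc 0 (staircase F α t),
      IntegrableOn (fun r => abelKernel (1 - β) (s - r) * h' r) (Ioi 0) := fun s hs => by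
    obtain ⟨u, -, rfl⟩ := hsurj s hs.1.le
    exact (caputoExistsAt_iff hS hβ').1 (hp.exists_deriv u hs.1)
  have heq : ∀ s ∈ Ioc 0 (staircase F α t), abelIntegral (1 - β) h' s = -a * h s := fun s hs => by
    obtain ⟨u, hu0, rfl⟩ := hsurj s hs.1.le
    rw [happly u hu0, ← caputoDeriv_eq hS hβ' p u]
    linear_combination hp.equation u hs.1
  have hmain := eq_mul_mittagLeffler_of_caputo hβ hβ'
    hS.strictMono_lastTime.monotone.countable_not_continuousAt hcont hderiv hint heq
    ⟨hS.apply_nonneg ht, le_rfl⟩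
  have hzero : h 0 = p₀ - k := by simpa only [hS.zero, hp.initial] using happly 0 le_rfl
  rw [happly t ht, hzero] at hmain
  linear_combination hmain

theorem solvesCaputo_of_eq_mittagLeffler (hS : IsClock (staircase F α))
    (hF : pointsOfChange (staircase F α) = F) (hβ : 0 < β) (hβ' : β < 1)
    (hp : ∀ t, 0 ≤ t → p t = k + (p₀ - k) * mittagLeffler β 1 (-a * staircase F α t ^ β)) :
    SolvesCaputo F α β a (a * k) p₀ p := by
  have hβ1 : 0 < 1 - β := sub_pos.2 hβ'
  let G : ℝ → ℝ := fun s => k + (p₀ - k) * mittagLeffler β 1 (-a * s ^ β)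
  let c : ℝ := (p₀ - k) * -a
  have hcont : Continuous G :=
    continuous_const.add ((continuous_mittagLeffler_mul_rpow hβ 1 (-a)).const_mul _)
  have hG : ∀ s, 0 < s → HasDerivAt G (c * mittagLefflerKernel β β (-a) s) s := fun s hs => by
    simpa only [c, mul_assoc] using
      ((hasDerivAt_mittagLeffler_mul_rpow hβ (-a) hs).const_mul (p₀ - k)).const_add k
  have hderiv : ∀ s, 0 < s → fractalDeriv F α p (lastTime (staircase F α) s) =
      c * mittagLefflerKernel β β (-a) s := fun s hs =>
    fractalDeriv_lastTime hS hF hp hs (hG s hs)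
  have hcaputo : ∀ t, 0 < staircase F α t → caputoDeriv F α β p t =
      c * mittagLeffler β 1 (-a * staircase F α t ^ β) := fun t ht => by
    rw [caputoDeriv_eq hS hβ', abelIntegral_congr _ _ hderiv, abelIntegral_const_mul,
      abelIntegral_mittagLefflerKernel hβ hβ1 hβ, sub_add_cancel, mittagLefflerKernel_one ht]
  refine ⟨isPricePath_of_eq_comp_staircase hS hF hp hcont.continuousOn
    fun s hs => (hG s hs).differentiableAt, ?_, fun t _ => ?_, fun t ht => ?_⟩
  · rw [hp 0 le_rfl, hS.zero, Real.zero_rpow hβ.ne', mul_zero, mittagLeffler_zero hβ,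
      Real.Gamma_one]
    ring
  · have hint := integrableOn_abelKernel_mul_mittagLefflerKernel hβ hβ1 hβ (-a) (staircase F α t)
    refine (caputoExistsAt_iff hS hβ').2 <|
      IntegrableOn.congr_fun (hint.const_mul c) (fun s hs => ?_) measurableSet_Ioi
    simp only [hderiv s hs, mul_left_comm]
  · rw [hcaputo t ht, hp t (hS.pos_of_apply_pos ht).le]
    ring

theorem solvesCaputo_iff (hS : IsClock (staircase F α))
    (hF : pointsOfChange (staircase F α) = F) (hβ : 0 < β) (hβ' : β < 1) :
    SolvesCaputo F α β a (a * k) p₀ p ↔ ∀ t : ℝ, 0 ≤ t →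
      p t = p₀ * fractalMittagLeffler F α β 1 (-a * staircase F α t ^ β) +
        k * (1 - fractalMittagLeffler F α β 1 (-a * staircase F α t ^ β)) := by
  have hform : ∀ E : ℝ, p₀ * E + k * (1 - E) = k + (p₀ - k) * E := fun E => by ring
  simp only [fractalMittagLeffler_eq hS hβ, hform]
  exact ⟨fun h t ht => h.eq_mittagLeffler hS hF hβ hβ' ht,
    solvesCaputo_of_eq_mittagLeffler hS hF hβ hβ'⟩

end FractalCaputo

end FractalCalculus

end

open FractalCalculus in
theorem mainTheorem7 (F : Set ℝ) (α β : ℝ) (hα : 0 < α) (hα' : α ≤ 1) (hβ : 0 < β) (hβ' : β < 1)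
    (hF : IsAlphaPerfect F α) (hS : Tendsto (staircase F α) atTop atTop)
    (d₀ d₁ s₀ s₁ : ℝ) (h₁ : d₁ + s₁ ≠ 0) :
    (∀ z : ℝ, Summable (mittagLefflerTerm F α β 1 z)) ∧
    (∀ (lam p₀ : ℝ) (p : ℝ → ℝ),
      SolvesCaputo F α β (lam * (d₁ + s₁)) (lam * (d₀ + s₀)) p₀ p ↔
        ∀ t : ℝ, 0 ≤ t →
          p t = p₀ * fractalMittagLeffler F α β 1 (-(lam * (d₁ + s₁)) * staircase F α t ^ β) +
            (d₀ + s₀) / (d₁ + s₁) *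
              (1 - fractalMittagLeffler F α β 1
                (-(lam * (d₁ + s₁)) * staircase F α t ^ β))) ∧
    (∀ (d₂ s₂ : ℝ), d₂ + s₂ ≠ 0 → ∀ (p₀ : ℝ) (p : ℝ → ℝ),
      SolvesCaputo F α β (-((d₁ + s₁) / (d₂ + s₂))) (-((d₀ + s₀) / (d₂ + s₂))) p₀ p ↔
        ∀ t : ℝ, 0 ≤ t →
          p t = p₀ * fractalMittagLeffler F α β 1
              ((d₁ + s₁) / (d₂ + s₂) * staircase F α t ^ β) +
            (d₀ + s₀) / (d₁ + s₁) *
              (1 - fractalMittagLeffler F α β 1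
                ((d₁ + s₁) / (d₂ + s₂) * staircase F α t ^ β))) := by
  have hclock := hF.isClock hα hS
  have hF' := hF.pointsOfChange_eq
  refine ⟨fun z => ?_, fun lam p₀ p => ?_, fun d₂ s₂ h₂ p₀ p => ?_⟩
  · rw [mittagLefflerTerm_eq hclock hβ]
    exact summable_mittagLeffler hβ 1 z
  · have e : lam * (d₀ + s₀) = lam * (d₁ + s₁) * ((d₀ + s₀) / (d₁ + s₁)) := by field_simp
    rw [e]
    exact solvesCaputo_iff hclock hF' hβ hβ'
  · have e : -((d₀ + s₀) / (d₂ + s₂)) =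
        -((d₁ + s₁) / (d₂ + s₂)) * ((d₀ + s₀) / (d₁ + s₁)) := by field_simp
    rw [e]
    have h := solvesCaputo_iff hclock hF' (a := -((d₁ + s₁) / (d₂ + s₂)))
      (k := (d₀ + s₀) / (d₁ + s₁)) (p₀ := p₀) hβ hβ' (p := p)
    rwa [neg_neg] at h
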